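/- **Setting.** Let $L,n\ge 1$, $M\ge 2$. For a tensor $X\in\mathbb R^{a\times n\times n}$ write $X(i,:,:)$ for its layers, $\|X\|_F$ for its Frobenius norm and $\|X\|=\max\{\sum_{l,i,j}X(l,i,j)u_lv_iw_j:\|u\|=\|v\|=\|w\|=1\}$ for its spectral norm. For $A\in\mathbb R^{a\times b}$ let $[X\times_1A](j,:,:)=\sum_i A(i,j)X(i,:,:)$; for $Y\in\mathbb R^{b\times n\times n}$ let $X\times_{2,3}Y\in\mathbb R^{a\times b}$ have entries $\sum_{j_2,j_3}X(i,j_2,j_3)Y(k,j_2,j_3)$. For matrices, $\sigma_r$ is the $r$-th largest singular value, $\|\cdot\|$ the operator norm, $\|\cdot\|_F$ the Frobenius norm. Let $Q_*\in\mathbb R^{M\times n\times n}$ have symmetric layers with $\operatorname{rank}Q_*(m,:,:)=K_m$, let $W_*\in\mathbb R^{L\times M}$ satisfy $W_*^TW_*=I$, and put $P_*=Q_*\times_1W_*^T$, $A=P_*+\Delta$, where $\Delta\in\mathbb R^{L\times n\times n}$ has symmetric layers. ALMA iterates are sequences with $(W^{(1)})^TW^{(1)}=I$ and, for $t\ge1$,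 $Q^{(t+1)}=\Pi_{\mathbf K}(A\times_1W^{(t)})$ (each layer $m$ is replaced by a Frobenius-nearest matrix of rank at most $K_m$) and $W^{(t+1)}=\Pi_o(A\times_{2,3}Q^{(t+1)})$ with $\Pi_o(X)=X(X^TX)^{-1/2}$. Let $\Pi_m^\perp$ be the orthogonal projection of $\mathbb R^n$ onto the orthogonal complement of the column space of $Q_*(m,:,:)$, and let $\Pi_{T,K_m}$ replace every layer $S$ of a tensor by $S-\Pi_m^\perp S\,\Pi_m^\perp$. Let $\mathrm{Skew}_M$ be the skew-symmetric $M\times M$ matrices, $$L_1=\{X\in\mathbb R^{M\times n\times n}:\Pi_m^\perp X(m,:,:)\Pi_m^\perp=0\ \ \forall m\},\qquad L_2=\{Q_*\times_1Y:Y\in\mathrm{Skew}_M\},$$ $$\kappa_H=\max_{X\neq0}\frac{\|P_{L_2}P_{L_1}X\|_F}{\|X\|_F},\qquad \kappa_0=\frac{\sigma_1(Q_*\times_{2,3}Q_*)}{\sigma_M(Q_*\times_{2,3}Q_*)},$$ where $P_S$ denotes the orthogonal projection onto a subspace $S$. Assume $L_1\cap L_2=\{0\}$ and $\sigma_M(Q_*\times_{2,3}Q_*)>0$.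 Let $$\lambda^{-1}=\min_{Y\in\mathrm{Skew}_M,\|Y\|_F=1}\|Q_*\times_1Y\|_F,\qquad C_H=\lambda\max_{Y\in\mathrm{Skew}_M,\|Y\|_F=1}\|Q_*\times_1Y\|_F,$$ and, with $L_0=\{W_*Y:Y\in\mathrm{Skew}_M\}\subset\mathbb R^{L\times M}$, let $$\|W\|_d=\sqrt{\lambda^2\|P_*\times_1(P_{L_0}W)\|_F^2+\|P_{L_0^\perp}W\|_F^2}.$$ With $\dot K=\sum_mK_m$, $\sigma_{\min}=\min_m\sigma_{K_m}(Q_*(m,:,:))$ and $s=\sigma_M(Q_*\times_{2,3}Q_*)$, put $$a_1=6\kappa_0\frac{\sqrt M\big(\max_m\|\Pi_{T,K_m}(\Delta)\times_{2,3}\Pi_{T,K_m}(\Delta)\|+2\max_m\|\Pi_{T,K_m}(Q_*)\times_{2,3}\Pi_{T,K_m}(\Delta)\|\big)}{s}+\frac{192\kappa_0\dot K\|\Delta\|^2(\|Q_*\|+\|\Delta\|)}{\sqrt M\,\sigma_{\min}\,s},$$ $$a_2=\frac{192\kappa_0\dot K\|Q_*\|^2(\|Q_*\|+\|\Delta\|)}{\sqrt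 M\,\sigma_{\min}\,s}+6\kappa_0,\qquad R=\min\Big(\frac{1-\kappa_H}{2C_H(a_2+80\kappa_0^2+32\kappa_0^3)},\ \frac{\sigma_{\min}}{4\|Q_*\|}\Big).$$ **Lemma.** If $\|\Delta\|\le\frac14\sigma_{\min}$, $\ \dfrac{2C_Ha_1}{1-\kappa_H}\le R\ $ and $\ \|W^{(1)}-W_*\|_d\le R$, then for all $t\ge1$ $$\|W^{(t+1)}-W_*\|_d\le\frac{1+\kappa_H}2\|W^{(t)}-W_*\|_d+C_Ha_1 .$$ Consequently the sequence $\|W^{(t)}-W_*\|_d$ is bounded and $\displaystyle\limsup_{t\to\infty}\|W^{(t)}-W_*\|_d\le\frac{2C_Ha_1}{1-\kappa_H}$. -/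

import Mathlib

open Matrix Filter
open scoped Matrix.Norms.L2Operator

noncomputable section

namespace ALMA

/-! ## Tensors, matrices and their norms -/

/-- Real `d × n × n` tensors.  The norm `‖X‖` of this space is the Frobenius norm. -/
abbrev Tensor (d n : ℕ) : Type := EuclideanSpace ℝ (Fin d × Fin n × Fin n)

/-- The layer `X(m,:,:)`. -/
def slice {d n : ℕ} (X : Tensor d n) (m : Fin d) : Matrix (Fin n) (Fin n) ℝ :=
  Matrix.of fun i j => X (m, i, j)

/-- The tensor with prescribed layers. -/
def ofSlices {d n : ℕ} (S : Fin d → Matrix (Fin n) (Fin n) ℝ) : Tensor d n :=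
  WithLp.toLp 2 fun p => S p.1 p.2.1 p.2.2

/-- Mode-1 product: `[X ×₁ A](j,:,:) = ∑ i, A(i,j) X(i,:,:)`. -/
def mode1 {a b n : ℕ} (X : Tensor a n) (A : Matrix (Fin a) (Fin b) ℝ) : Tensor b n :=
  ofSlices fun j => ∑ i, A i j • slice X i

/-- Mode-(2,3) product: `[X ×₂₃ Y](i,k) = ∑ j₂ j₃, X(i,j₂,j₃) Y(k,j₂,j₃)`. -/
def mode23 {a b n : ℕ} (X : Tensor a n) (Y : Tensor b n) : Matrix (Fin a) (Fin b) ℝ :=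
  Matrix.of fun i k => ∑ j₂, ∑ j₃, X (i, j₂, j₃) * Y (k, j₂, j₃)

/-- The spectral norm of a tensor:
the maximum of `X ×₁ u ×₂ v ×₃ w` over unit vectors `u`, `v`, `w`. -/
def tensorNorm {d n : ℕ} (X : Tensor d n) : ℝ :=
  sSup {r | ∃ (u : EuclideanSpace ℝ (Fin d)) (v w : EuclideanSpace ℝ (Fin n)),
    ‖u‖ = 1 ∧ ‖v‖ = 1 ∧ ‖w‖ = 1 ∧ r = ∑ l, ∑ i, ∑ j, X (l, i, j) * u l * v i * w j}

/-- A matrix as an element of the Euclidean space of its entries. -/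
def vecM {a b : ℕ} (W : Matrix (Fin a) (Fin b) ℝ) : EuclideanSpace ℝ (Fin a × Fin b) :=
  WithLp.toLp 2 fun p => W p.1 p.2

/-- The inverse of `vecM`. -/
def unvecM {a b : ℕ} (x : EuclideanSpace ℝ (Fin a × Fin b)) : Matrix (Fin a) (Fin b) ℝ :=
  Matrix.of fun i j => x (i, j)

/-- Frobenius norm of a matrix. -/
def frob {a b : ℕ} (W : Matrix (Fin a) (Fin b) ℝ) : ℝ := ‖vecM W‖

/-- Operator norm of a matrix with respect to the Euclidean norms. -/
def opNorm {a b : ℕ} (X : Matrix (Fin a) (Fin b) ℝ) : ℝ := ‖X‖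

/-- The `r`-th largest singular value of a matrix, `r ≥ 1`
(Mathlib numbers the singular values from `0`). -/
def sigma {a b : ℕ} (X : Matrix (Fin a) (Fin b) ℝ) (r : ℕ) : ℝ :=
  (Matrix.toEuclideanLin X).singularValues (r - 1)

/-! ## The alternating minimization algorithm -/

/-- `Π_o(X) = X (Xᵀ X)^{-1/2}`; over `ℝ` the conjugate transpose `Xᴴ` is the transpose. -/
def polar {a b : ℕ} (X : Matrix (Fin a) (Fin b) ℝ) : Matrix (Fin a) (Fin b) ℝ :=
  X * (Matrix.isHermitian_conjTranspose_mul_self X).cfc (fun t : ℝ => t ^ (-(1 / 2) : ℝ))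

/-- `Y = Π_K(X)`: each layer of `Y` is a matrix of rank at most `K_m`
that is nearest to the layer of `X` in Frobenius norm. -/
def IsRankProj {M n : ℕ} (K : Fin M → ℕ) (X Y : Tensor M n) : Prop :=
  ∀ m, (slice Y m).rank ≤ K m ∧
    ∀ Z : Matrix (Fin n) (Fin n) ℝ, Z.rank ≤ K m →
      frob (slice X m - slice Y m) ≤ frob (slice X m - Z)

/-- `W⁽¹⁾, W⁽²⁾, …` and `Q⁽²⁾, Q⁽³⁾, …` are iterates of the algorithm with input tensor `A`,
rank bounds `K` and an initialization `W⁽¹⁾` with orthonormal columns. -/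
structure IsIterates {L M n : ℕ} (A : Tensor L n) (K : Fin M → ℕ)
    (W : ℕ → Matrix (Fin L) (Fin M) ℝ) (Q : ℕ → Tensor M n) : Prop where
  init : (W 1)ᵀ * W 1 = 1
  stepQ : ∀ t, 1 ≤ t → IsRankProj K (mode1 A (W t)) (Q (t + 1))
  stepW : ∀ t, 1 ≤ t → W (t + 1) = polar (mode23 A (Q (t + 1)))

/-! ## The tangent spaces and the contraction factor -/

/-- The orthogonal projection `Π_{U^⊥} = I - U Uᵀ` onto the orthogonal complement
of the column space of `X`, as a matrix. -/
def perpProj {n : ℕ} (X : Matrix (Fin n) (Fin n) ℝ) : Matrix (Fin n) (Fin n) ℝ :=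
  Matrix.toEuclideanLin.symm
    ((LinearMap.range (Matrix.toEuclideanLin X))ᗮ.starProjection).toLinearMap

/-- `Π_{T,K_m}`: every layer `S` of the tensor is replaced by
`S - Π_{U_m^⊥} S Π_{U_m^⊥}`, where `U_m` spans the column space of `Q(m,:,:)`. -/
def tangentProj {d M n : ℕ} (Q : Tensor M n) (m : Fin M) (X : Tensor d n) : Tensor d n :=
  ofSlices fun l => slice X l - perpProj (slice Q m) * slice X l * perpProj (slice Q m)

/-- `L₁ = {X : Π_{U_m^⊥} X(m,:,:) Π_{U_m^⊥} = 0 for all m}`. -/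
def L1 {M n : ℕ} (Q : Tensor M n) : Submodule ℝ (Tensor M n) where
  carrier := {X | ∀ m, perpProj (slice Q m) * slice X m * perpProj (slice Q m) = 0}
  zero_mem' := fun m => by
    have h : slice (0 : Tensor M n) m = 0 := by ext i j; simp [slice]
    simp [h]
  add_mem' := fun {X Y} hX hY m => by
    have h : slice (X + Y) m = slice X m + slice Y m := by ext i j; simp [slice]
    rw [h, Matrix.mul_add, Matrix.add_mul, hX m, hY m, add_zero]
  smul_mem' := fun c X hX m => by
    have h : slice (c • X) m = c • slice X m := by ext i j; simp [slice]
    rw [h, Matrix.mul_smul, Matrix.smul_mul, hX m, smul_zero]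

/-- `L₂ = {Q ×₁ Y : Y skew-symmetric}`. -/
def L2 {M n : ℕ} (Q : Tensor M n) : Submodule ℝ (Tensor M n) where
  carrier := {X | ∃ Y : Matrix (Fin M) (Fin M) ℝ, Yᵀ = -Y ∧ X = mode1 Q Y}
  zero_mem' := ⟨0, by simp, by ext p; simp [mode1, ofSlices]⟩
  add_mem' := by
    rintro _ _ ⟨Y, hY, rfl⟩ ⟨Z, hZ, rfl⟩
    refine ⟨Y + Z, by rw [transpose_add, hY, hZ, neg_add], ?_⟩
    ext p
    simp [mode1, ofSlices, add_mul, Finset.sum_add_distrib, Matrix.sum_apply]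
  smul_mem' := by
    rintro c _ ⟨Y, hY, rfl⟩
    refine ⟨c • Y, by rw [transpose_smul, hY, smul_neg], ?_⟩
    ext p
    simp [mode1, ofSlices, Finset.mul_sum, Matrix.sum_apply, mul_assoc]

/-- `κ_H = max_X ‖P_{L₂} P_{L₁} X‖_F / ‖X‖_F`. -/
def kappaH {M n : ℕ} (Q : Tensor M n) : ℝ :=
  sSup {r | ∃ X : Tensor M n, X ≠ 0 ∧
    r = ‖(L2 Q).starProjection ((L1 Q).starProjection X)‖ / ‖X‖}

/-- `κ₀`: the condition number of `Q ×₂₃ Q`. -/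
def kappa0 {M n : ℕ} (Q : Tensor M n) : ℝ :=
  sigma (mode23 Q Q) 1 / sigma (mode23 Q Q) M

/-- The values `‖Q ×₁ Y‖_F` over skew-symmetric `Y` with `‖Y‖_F = 1`. -/
def skewValues {M n : ℕ} (Q : Tensor M n) : Set ℝ :=
  {r | ∃ Y : Matrix (Fin M) (Fin M) ℝ, Yᵀ = -Y ∧ frob Y = 1 ∧ r = ‖mode1 Q Y‖}

/-- `C_H`. -/
def CH {M n : ℕ} (Q : Tensor M n) : ℝ := sSup (skewValues Q) / sInf (skewValues Q)

/-! ## The weighted metric -/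

/-- `L₀ = {W_* Y : Y skew-symmetric}`, in the Euclidean space of `L × M` matrices. -/
def L0 {L M : ℕ} (Ws : Matrix (Fin L) (Fin M) ℝ) :
    Submodule ℝ (EuclideanSpace ℝ (Fin L × Fin M)) where
  carrier := {x | ∃ Y : Matrix (Fin M) (Fin M) ℝ, Yᵀ = -Y ∧ x = vecM (Ws * Y)}
  zero_mem' := ⟨0, by simp, by ext p; simp [vecM]⟩
  add_mem' := by
    rintro _ _ ⟨Y, hY, rfl⟩ ⟨Z, hZ, rfl⟩
    refine ⟨Y + Z, by rw [transpose_add, hY, hZ, neg_add], ?_⟩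
    ext p
    simp [vecM, Matrix.mul_add]
  smul_mem' := by
    rintro c _ ⟨Y, hY, rfl⟩
    refine ⟨c • Y, by rw [transpose_smul, hY, smul_neg], ?_⟩
    ext p
    simp [vecM]

/-- The true tensor `P_* = Q_* ×₁ W_*ᵀ`. -/
def trueTensor {L M n : ℕ} (Q : Tensor M n) (Ws : Matrix (Fin L) (Fin M) ℝ) : Tensor L n :=
  mode1 Q Wsᵀ

/-- `‖W‖_d = √((λ ‖P_* ×₁ P_{L₀} W‖_F)² + ‖P_{L₀^⊥} W‖_F²)` with
`λ = 1 / min {‖Q_* ×₁ Y‖_F : Y skew-symmetric, ‖Y‖_F = 1}`. -/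
def dNorm {L M n : ℕ} (Q : Tensor M n) (Ws W : Matrix (Fin L) (Fin M) ℝ) : ℝ :=
  √(((sInf (skewValues Q))⁻¹ *
        ‖mode1 (trueTensor Q Ws) (unvecM ((L0 Ws).starProjection (vecM W)))‖) ^ 2
      + ‖(L0 Ws)ᗮ.starProjection (vecM W)‖ ^ 2)

/-! ## The constants of the convergence result -/

/-- `min_m σ_{K_m}(Q(m,:,:))`. -/
def sigmaMin {M n : ℕ} (K : Fin M → ℕ) (Q : Tensor M n) : ℝ := ⨅ m, sigma (slice Q m) (K m)

/-- The constant `a₁`. -/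
def a1 {L M n : ℕ} (K : Fin M → ℕ) (Q : Tensor M n) (Δ : Tensor L n) : ℝ :=
  6 * kappa0 Q *
      (√M * ((⨆ m, opNorm (mode23 (tangentProj Q m Δ) (tangentProj Q m Δ)))
          + 2 * ⨆ m, opNorm (mode23 (tangentProj Q m Q) (tangentProj Q m Δ)))
        / sigma (mode23 Q Q) M)
    + 192 * kappa0 Q * (∑ m, (K m : ℝ)) * tensorNorm Δ ^ 2 * (tensorNorm Q + tensorNorm Δ)
        / (√M * sigmaMin K Q * sigma (mode23 Q Q) M)

/-- The constant `a₂`. -/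
def a2 {L M n : ℕ} (K : Fin M → ℕ) (Q : Tensor M n) (Δ : Tensor L n) : ℝ :=
  192 * kappa0 Q * (∑ m, (K m : ℝ)) * tensorNorm Q ^ 2 * (tensorNorm Q + tensorNorm Δ)
      / (√M * sigmaMin K Q * sigma (mode23 Q Q) M)
    + 6 * kappa0 Q

/-- The radius
`min ((1 - κ_H) / (2 C_H (a₂ + 80 κ₀² + 32 κ₀³)), min_m σ_{K_m}(Q(m,:,:)) / (4 ‖Q‖))`. -/
def radius {L M n : ℕ} (K : Fin M → ℕ) (Q : Tensor M n) (Δ : Tensor L n) : ℝ :=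
  min ((1 - kappaH Q) / (2 * CH Q * (a2 K Q Δ + 80 * kappa0 Q ^ 2 + 32 * kappa0 Q ^ 3)))
    (sigmaMin K Q / (4 * tensorNorm Q))

end ALMA

end

/-!
The iteration map is expanded to first order around `W_*`, and the expansion is a contraction in the
metric `‖·‖_d`.

Write `G = Q_* ×₂₃ Q_*`, `s = σ_M(G)`, `E = W - W_*`, and let `Y` be the skew-symmetric part of
`W_*ᵀ E`.  Since `W` and `W_*` have orthonormal columns, the symmetric part is `-EᵀE/2`, hence of
second order.

* Rank projection.  A best approximation of rank `k` of `S + Z`, where `S` has rank `k`, differs from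
  the tangential projection of `S + Z` by a matrix of rank at most `3k` and operator norm at most
  `12 ‖Z‖² / σ_k(S)` (`IsBestApprox.opNorm_sub_tangent_le`).  The proof uses minimality only,
  by exchanging one direction of the row space of the approximation for a vector of the kernel of
  `S` (`IsBestApprox.norm_mv_le`).  Hence `Q⁺ = P_{L₁}(A ×₁ W)` up to second-order terms, and
  `A ×₂₃ Q⁺ = W_* G + W_* B + N` with `B = Q_* ×₂₃ P_{L₁}(Q_* ×₁ Y)` and `N` consisting of noise
  and of terms quadratic in `E` (`exists_expansion`).  In the second-order terms the part of `P_*`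
  is estimated in Frobenius norm and the part of `Δ` by trace duality, together with
  `K_m σ_min² ≤ σ₁(G)` and `M s ≤ (∑ K_m) ‖Q_*‖²`; this accounts for the factor `1/√M` in `a₁`, `a₂`.

* Polar factor.  If `W⁺ H = W_* G + W_* B + N` is a polar decomposition, the symmetry of `H` shows
  that the skew-symmetric part of `W_*ᵀ (W⁺ - W_*)` solves, up to second-order terms and `N`, the
  Lyapunov equation `G Y⁺ + Y⁺ G = B - Bᵀ`, whose inverse has norm at most `1/(2s)`
  (`polar_expansion`).

* Contraction.  The solution of this equation is exactly the one with
  `Q_* ×₁ Y⁺ = P_{L₂} P_{L₁} (Q_* ×₁ Y)` (`exists_skew_starProjection_L2`), so the linear part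
  contracts `‖Q_* ×₁ Y‖_F` by the factor `κ_H`, and `κ_H < 1` by compactness (`kappaH_lt_one`).

Below the radius the quadratic terms cost at most half of the gap `1 - κ_H`
(`quadratic_terms_le`); the radius is preserved, and the recursion gives the limit superior.
-/

noncomputable section

namespace ALMA

/-! ### Frobenius norm, operator norm and the trace inner product -/

/-- The action of a matrix on Euclidean vectors. -/
def mv {a b : ℕ} (A : Matrix (Fin a) (Fin b) ℝ) (x : EuclideanSpace ℝ (Fin b)) :
    EuclideanSpace ℝ (Fin a) := WithLp.toLp 2 (A *ᵥ x.ofLp)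

section mv
variable {a b c : ℕ}

lemma mv_eq_toEuclideanLin (A : Matrix (Fin a) (Fin b) ℝ) (x : EuclideanSpace ℝ (Fin b)) :
    mv A x = Matrix.toEuclideanLin A x := rfl

lemma mv_mul (A : Matrix (Fin a) (Fin b) ℝ) (B : Matrix (Fin b) (Fin c) ℝ)
    (x : EuclideanSpace ℝ (Fin c)) : mv (A * B) x = mv A (mv B x) := by
  simp [mv, Matrix.mulVec_mulVec]

lemma mv_one (x : EuclideanSpace ℝ (Fin a)) : mv (1 : Matrix (Fin a) (Fin a) ℝ) x = x := by
  simp [mv]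

lemma add_mv (A B : Matrix (Fin a) (Fin b) ℝ) (x : EuclideanSpace ℝ (Fin b)) :
    mv (A + B) x = mv A x + mv B x := by
  simp [mv, Matrix.add_mulVec]

lemma sub_mv (A B : Matrix (Fin a) (Fin b) ℝ) (x : EuclideanSpace ℝ (Fin b)) :
    mv (A - B) x = mv A x - mv B x := by
  simp [mv, Matrix.sub_mulVec]

lemma zero_mv (x : EuclideanSpace ℝ (Fin b)) : mv (0 : Matrix (Fin a) (Fin b) ℝ) x = 0 := by
  simp [mv]

lemma mv_zero (A : Matrix (Fin a) (Fin b) ℝ) : mv A 0 = 0 := by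
  simp [mv]

lemma mv_add (A : Matrix (Fin a) (Fin b) ℝ) (x y : EuclideanSpace ℝ (Fin b)) :
    mv A (x + y) = mv A x + mv A y := by
  simp [mv, Matrix.mulVec_add]

lemma mv_sub (A : Matrix (Fin a) (Fin b) ℝ) (x y : EuclideanSpace ℝ (Fin b)) :
    mv A (x - y) = mv A x - mv A y := by
  simp [mv, Matrix.mulVec_sub]

lemma mv_smul (A : Matrix (Fin a) (Fin b) ℝ) (r : ℝ) (x : EuclideanSpace ℝ (Fin b)) :
    mv A (r • x) = r • mv A x := by
  simp [mv, Matrix.mulVec_smul]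

lemma inner_eq_dotProduct (x y : EuclideanSpace ℝ (Fin a)) :
    inner ℝ x y = x.ofLp ⬝ᵥ y.ofLp := by
  rw [EuclideanSpace.inner_eq_star_dotProduct, dotProduct_comm]; simp

lemma inner_mv (A : Matrix (Fin a) (Fin b) ℝ) (x : EuclideanSpace ℝ (Fin b))
    (y : EuclideanSpace ℝ (Fin a)) : inner ℝ (mv A x) y = inner ℝ x (mv Aᵀ y) := by
  simp only [inner_eq_dotProduct, mv]
  rw [Matrix.mulVec_transpose, dotProduct_comm, dotProduct_mulVec, dotProduct_comm]

lemma norm_mv_le (A : Matrix (Fin a) (Fin b) ℝ) (x : EuclideanSpace ℝ (Fin b)) :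
    ‖mv A x‖ ≤ ‖A‖ * ‖x‖ := Matrix.l2_opNorm_mulVec A x

lemma opNorm_le_of_mv {A : Matrix (Fin a) (Fin b) ℝ} {C : ℝ} (hC : 0 ≤ C)
    (h : ∀ x, ‖mv A x‖ ≤ C * ‖x‖) : ‖A‖ ≤ C :=
  ContinuousLinearMap.opNorm_le_bound _ hC h

lemma norm_transpose (A : Matrix (Fin a) (Fin b) ℝ) : ‖Aᵀ‖ = ‖A‖ := by
  rw [← Matrix.l2_opNorm_conjTranspose A, Matrix.conjTranspose_eq_transpose_of_trivial]

/-- The `j`-th column of a matrix. -/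
def colv (A : Matrix (Fin a) (Fin b) ℝ) (j : Fin b) : EuclideanSpace ℝ (Fin a) :=
  WithLp.toLp 2 fun i => A i j

lemma colv_eq_mv (A : Matrix (Fin a) (Fin b) ℝ) (j : Fin b) :
    colv A j = mv A (EuclideanSpace.single j 1) := by
  ext i; simp [colv, mv]

lemma colv_mul (A : Matrix (Fin a) (Fin b) ℝ) (B : Matrix (Fin b) (Fin c) ℝ) (j : Fin c) :
    colv (A * B) j = mv A (colv B j) := by
  rw [colv_eq_mv, colv_eq_mv, mv_mul]

lemma inner_vecM (X Y : Matrix (Fin a) (Fin b) ℝ) :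
    inner ℝ (vecM X) (vecM Y) = (Xᵀ * Y).trace := by
  simp only [vecM, PiLp.inner_apply, Fintype.sum_prod_type, Matrix.trace, Matrix.diag,
    Matrix.mul_apply, Matrix.transpose_apply]
  rw [Finset.sum_comm]
  simp [mul_comm]

lemma frob_sq (X : Matrix (Fin a) (Fin b) ℝ) : frob X ^ 2 = (Xᵀ * X).trace := by
  rw [← inner_vecM, real_inner_self_eq_norm_sq, frob]

lemma frob_nonneg (X : Matrix (Fin a) (Fin b) ℝ) : 0 ≤ frob X := norm_nonneg _

lemma trace_transpose_mul_le (X Y : Matrix (Fin a) (Fin b) ℝ) :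
    (Xᵀ * Y).trace ≤ frob X * frob Y := by
  rw [← inner_vecM]; exact real_inner_le_norm _ _

lemma vecM_add (X Y : Matrix (Fin a) (Fin b) ℝ) : vecM (X + Y) = vecM X + vecM Y := rfl
lemma vecM_sub (X Y : Matrix (Fin a) (Fin b) ℝ) : vecM (X - Y) = vecM X - vecM Y := rfl
lemma vecM_smul (r : ℝ) (X : Matrix (Fin a) (Fin b) ℝ) : vecM (r • X) = r • vecM X := rfl

lemma frob_add_le (X Y : Matrix (Fin a) (Fin b) ℝ) : frob (X + Y) ≤ frob X + frob Y := by
  simp only [frob, vecM_add]; exact norm_add_le _ _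
lemma frob_sub_le (X Y : Matrix (Fin a) (Fin b) ℝ) : frob (X - Y) ≤ frob X + frob Y := by
  simp only [frob, vecM_sub]; exact norm_sub_le _ _
lemma frob_smul (r : ℝ) (X : Matrix (Fin a) (Fin b) ℝ) : frob (r • X) = |r| * frob X := by
  simp only [frob, vecM_smul, norm_smul, Real.norm_eq_abs]
lemma frob_transpose (X : Matrix (Fin a) (Fin b) ℝ) : frob Xᵀ = frob X := by
  have : frob Xᵀ ^ 2 = frob X ^ 2 := by
    rw [frob_sq, frob_sq, transpose_transpose, Matrix.trace_mul_comm]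
  exact (sq_eq_sq₀ (frob_nonneg _) (frob_nonneg _)).1 this
lemma frob_eq_zero {X : Matrix (Fin a) (Fin b) ℝ} (h : frob X = 0) : X = 0 := by
  have : vecM X = 0 := norm_eq_zero.1 h
  ext i j
  exact congrArg (fun v : EuclideanSpace ℝ (Fin a × Fin b) => v (i, j)) this

lemma frob_sq_eq_sum_colv (X : Matrix (Fin a) (Fin b) ℝ) :
    frob X ^ 2 = ∑ j, ‖colv X j‖ ^ 2 := by
  simp only [frob, EuclideanSpace.norm_sq_eq, Fintype.sum_prod_type, vecM, colv]
  rw [Finset.sum_comm]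

lemma norm_colv_le (X : Matrix (Fin a) (Fin b) ℝ) (j : Fin b) : ‖colv X j‖ ≤ frob X := by
  refine le_of_sq_le_sq ?_ (frob_nonneg _)
  rw [frob_sq_eq_sum_colv]
  exact Finset.single_le_sum (f := fun j => ‖colv X j‖ ^ 2) (fun _ _ => sq_nonneg _)
    (Finset.mem_univ j)

lemma frob_mul_le (A : Matrix (Fin a) (Fin b) ℝ) (B : Matrix (Fin b) (Fin c) ℝ) :
    frob (A * B) ≤ ‖A‖ * frob B := by
  refine le_of_sq_le_sq ?_ (mul_nonneg (norm_nonneg _) (frob_nonneg _))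
  rw [mul_pow, frob_sq_eq_sum_colv, frob_sq_eq_sum_colv, Finset.mul_sum]
  refine Finset.sum_le_sum fun j _ => ?_
  rw [colv_mul, ← mul_pow]
  exact pow_le_pow_left₀ (norm_nonneg _) (norm_mv_le _ _) 2

lemma frob_mul_le' (A : Matrix (Fin a) (Fin b) ℝ) (B : Matrix (Fin b) (Fin c) ℝ) :
    frob (A * B) ≤ frob A * ‖B‖ := by
  rw [← frob_transpose, transpose_mul, ← frob_transpose A, ← norm_transpose B, mul_comm]
  exact frob_mul_le _ _

lemma norm_mv_le_frob (A : Matrix (Fin a) (Fin b) ℝ) (x : EuclideanSpace ℝ (Fin b)) :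
    ‖mv A x‖ ≤ frob A * ‖x‖ := by
  -- regard `x` as a matrix with one column
  set X : Matrix (Fin b) (Fin 1) ℝ := Matrix.of fun i _ => x i
  have hX : colv X 0 = x := rfl
  have h1 := norm_colv_le (A * X) 0
  have h2 : ‖X‖ ≤ ‖x‖ := by
    refine opNorm_le_of_mv (norm_nonneg _) fun y => ?_
    have : mv X y = (y 0) • x := by
      ext i; simp [mv, Matrix.mulVec, dotProduct, X, mul_comm]
    have hy : ‖y‖ = |y 0| := by
      rw [EuclideanSpace.norm_eq]; simp [Real.sqrt_sq_eq_abs]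
    rw [this, norm_smul, hy, Real.norm_eq_abs, mul_comm]
  rw [colv_mul, hX] at h1
  exact h1.trans ((frob_mul_le' _ _).trans (mul_le_mul_of_nonneg_left h2 (frob_nonneg _)))

lemma opNorm_le_frob (A : Matrix (Fin a) (Fin b) ℝ) : ‖A‖ ≤ frob A :=
  opNorm_le_of_mv (frob_nonneg _) (norm_mv_le_frob A)

lemma norm_mv_of_isometry {V : Matrix (Fin a) (Fin b) ℝ} (hV : Vᵀ * V = 1)
    (x : EuclideanSpace ℝ (Fin b)) : ‖mv V x‖ = ‖x‖ := by
  have : ‖mv V x‖ ^ 2 = ‖x‖ ^ 2 := by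
    rw [← real_inner_self_eq_norm_sq, inner_mv, ← mv_mul, hV, mv_one, real_inner_self_eq_norm_sq]
  exact (sq_eq_sq₀ (norm_nonneg _) (norm_nonneg _)).1 this

lemma opNorm_le_one_of_isometry {V : Matrix (Fin a) (Fin b) ℝ} (hV : Vᵀ * V = 1) : ‖V‖ ≤ 1 :=
  opNorm_le_of_mv zero_le_one fun x => by rw [norm_mv_of_isometry hV, one_mul]

lemma frob_mul_of_isometry {V : Matrix (Fin a) (Fin b) ℝ} (hV : Vᵀ * V = 1)
    (X : Matrix (Fin b) (Fin c) ℝ) : frob (V * X) = frob X := by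
  have : frob (V * X) ^ 2 = frob X ^ 2 := by
    rw [frob_sq, frob_sq, transpose_mul, Matrix.mul_assoc, ← Matrix.mul_assoc Vᵀ, hV,
      Matrix.one_mul]
  exact (sq_eq_sq₀ (frob_nonneg _) (frob_nonneg _)).1 this

lemma frob_transpose_mul_le_of_isometry {V : Matrix (Fin a) (Fin b) ℝ} (hV : Vᵀ * V = 1)
    (X : Matrix (Fin a) (Fin c) ℝ) : frob (Vᵀ * X) ≤ frob X := by
  refine (frob_mul_le _ _).trans ?_
  rw [norm_transpose]
  exact mul_le_of_le_one_left (frob_nonneg _) (opNorm_le_one_of_isometry hV)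

/-- A bound of `‖A x‖` from below passes to Frobenius norms. -/
lemma le_frob_mul {A : Matrix (Fin a) (Fin b) ℝ} {C : ℝ} (hC : 0 ≤ C)
    (h : ∀ x, C * ‖x‖ ≤ ‖mv A x‖) (X : Matrix (Fin b) (Fin c) ℝ) :
    C * frob X ≤ frob (A * X) := by
  refine le_of_sq_le_sq ?_ (frob_nonneg _)
  rw [mul_pow, frob_sq_eq_sum_colv, frob_sq_eq_sum_colv, Finset.mul_sum]
  refine Finset.sum_le_sum fun j _ => ?_
  rw [colv_mul, ← mul_pow]
  exact pow_le_pow_left₀ (mul_nonneg hC (norm_nonneg _)) (h _) 2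

lemma trace_transpose_mul_mul_eq_sum (G : Matrix (Fin a) (Fin a) ℝ) (X : Matrix (Fin a) (Fin b) ℝ) :
    (Xᵀ * (G * X)).trace = ∑ j, inner ℝ (colv X j) (mv G (colv X j)) := by
  simp only [Matrix.trace, Matrix.diag]
  refine Finset.sum_congr rfl fun j _ => ?_
  rw [← colv_mul, inner_eq_dotProduct]
  simp [Matrix.mul_apply, colv, dotProduct]

/-- A lower bound of a quadratic form passes to the trace form. -/
lemma le_trace_transpose_mul_mul {G : Matrix (Fin a) (Fin a) ℝ} {s : ℝ}
    (h : ∀ x, s * ‖x‖ ^ 2 ≤ inner ℝ x (mv G x)) (X : Matrix (Fin a) (Fin b) ℝ) :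
    s * frob X ^ 2 ≤ (Xᵀ * (G * X)).trace := by
  rw [trace_transpose_mul_mul_eq_sum, frob_sq_eq_sum_colv, Finset.mul_sum]
  exact Finset.sum_le_sum fun j _ => h _

lemma trace_transpose_mul_mul_le {G : Matrix (Fin a) (Fin a) ℝ} {s : ℝ}
    (h : ∀ x, inner ℝ x (mv G x) ≤ s * ‖x‖ ^ 2) (X : Matrix (Fin a) (Fin b) ℝ) :
    (Xᵀ * (G * X)).trace ≤ s * frob X ^ 2 := by
  rw [trace_transpose_mul_mul_eq_sum, frob_sq_eq_sum_colv, Finset.mul_sum]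
  exact Finset.sum_le_sum fun j _ => h _

end mv

/-! ### Singular values as bounds of `‖A x‖` -/

section singular
open Module

variable {E F : Type*} [NormedAddCommGroup E] [InnerProductSpace ℝ E] [FiniteDimensional ℝ E]
  [NormedAddCommGroup F] [InnerProductSpace ℝ F] [FiniteDimensional ℝ F]

lemma norm_sq_eq_sum_singularValues (T : E →ₗ[ℝ] F) (x : E) :
    ‖T x‖ ^ 2 = ∑ i : Fin (finrank ℝ E), T.singularValues i ^ 2 *
      (inner ℝ (T.isSymmetric_adjoint_comp_self.eigenvectorBasis rfl i) x) ^ 2 := by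
  set b := T.isSymmetric_adjoint_comp_self.eigenvectorBasis rfl
  have h1 : ‖T x‖ ^ 2 = inner ℝ x ((LinearMap.adjoint T ∘ₗ T) x) := by
    rw [← real_inner_self_eq_norm_sq, LinearMap.comp_apply, LinearMap.adjoint_inner_right]
  rw [h1, ← b.sum_inner_mul_inner]
  refine Finset.sum_congr rfl fun i _ => ?_
  rw [← T.isSymmetric_adjoint_comp_self, T.isSymmetric_adjoint_comp_self.apply_eigenvectorBasis rfl,
    T.sq_singularValues_fin rfl, real_inner_comm]
  simp only [RCLike.ofReal_real_eq_id, id_eq, inner_smul_left, conj_trivial]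
  ring

lemma norm_apply_le_singularValues_zero (T : E →ₗ[ℝ] F) (x : E) :
    ‖T x‖ ≤ T.singularValues 0 * ‖x‖ := by
  refine le_of_sq_le_sq ?_ (mul_nonneg (T.singularValues_nonneg 0) (norm_nonneg _))
  rw [norm_sq_eq_sum_singularValues, mul_pow,
    ← (T.isSymmetric_adjoint_comp_self.eigenvectorBasis rfl).sum_sq_inner_right x, Finset.mul_sum]
  refine Finset.sum_le_sum fun i _ => mul_le_mul_of_nonneg_right ?_ (sq_nonneg _)
  exact pow_le_pow_left₀ (T.singularValues_nonneg _) (T.singularValues_antitone (Nat.zero_le _)) 2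

/-- On the orthogonal complement of the kernel, `T` is bounded below by its smallest nonzero
singular value. -/
lemma singularValues_mul_norm_le (T : E →ₗ[ℝ] F) {k : ℕ}
    (hk : finrank ℝ (LinearMap.range T) = k) {x : E} (hx : ∀ y, T y = 0 → inner ℝ y x = 0) :
    T.singularValues (k - 1) * ‖x‖ ≤ ‖T x‖ := by
  refine le_of_sq_le_sq ?_ (norm_nonneg _)
  rw [norm_sq_eq_sum_singularValues, mul_pow,
    ← (T.isSymmetric_adjoint_comp_self.eigenvectorBasis rfl).sum_sq_inner_right x, Finset.mul_sum]
  refine Finset.sum_le_sum fun i _ => ?_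
  by_cases hi : (i : ℕ) < k
  · refine mul_le_mul_of_nonneg_right ?_ (sq_nonneg _)
    exact pow_le_pow_left₀ (T.singularValues_nonneg _) (T.singularValues_antitone (by omega)) 2
  · have h0 : T.singularValues i = 0 :=
      T.singularValues_eq_zero_iff_le_finrank_range.2 (by omega)
    have hb : T (T.isSymmetric_adjoint_comp_self.eigenvectorBasis rfl i) = 0 := by
      have h1 : (LinearMap.adjoint T ∘ₗ T)
          (T.isSymmetric_adjoint_comp_self.eigenvectorBasis rfl i) = 0 := by
        rw [T.isSymmetric_adjoint_comp_self.apply_eigenvectorBasis rfl,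
          ← T.sq_singularValues_fin rfl, h0]
        simp
      rw [← norm_eq_zero, ← sq_eq_zero_iff, ← real_inner_self_eq_norm_sq,
        ← LinearMap.adjoint_inner_right, ← LinearMap.comp_apply, h1, inner_zero_right]
    rw [hx _ hb, h0]
    simp

end singular

section sigma
variable {a b : ℕ}

lemma sigma_nonneg (A : Matrix (Fin a) (Fin b) ℝ) (r : ℕ) : 0 ≤ sigma A r :=
  LinearMap.singularValues_nonneg _ _

lemma norm_mv_le_sigma_one (A : Matrix (Fin a) (Fin b) ℝ) (x : EuclideanSpace ℝ (Fin b)) :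
    ‖mv A x‖ ≤ sigma A 1 * ‖x‖ :=
  norm_apply_le_singularValues_zero (Matrix.toEuclideanLin A) x

lemma sigma_card_le_norm_mv (A : Matrix (Fin a) (Fin b) ℝ) (x : EuclideanSpace ℝ (Fin b)) :
    sigma A b * ‖x‖ ≤ ‖mv A x‖ := by
  rcases (sigma_nonneg A b).eq_or_lt' with h | h
  · rw [h, zero_mul]; exact norm_nonneg _
  rcases Nat.eq_zero_or_pos b with rfl | hb
  · have : x = 0 := Subsingleton.elim _ _
    simp [this]
  set T := Matrix.toEuclideanLin A
  have hr := T.singularValues_pos_iff_lt_finrank_range.1 h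
  have hle := LinearMap.finrank_range_le T
  have hdim : Module.finrank ℝ (EuclideanSpace ℝ (Fin b)) = b := by simp
  have hrank : Module.finrank ℝ (LinearMap.range T) = b := by omega
  refine singularValues_mul_norm_le T hrank fun y hy => ?_
  have hker : Module.finrank ℝ (LinearMap.ker T) = 0 := by
    have := LinearMap.finrank_range_add_finrank_ker T; omega
  have : y ∈ LinearMap.ker T := hy
  rw [Submodule.finrank_eq_zero.1 hker, Submodule.mem_bot] at this
  rw [this, inner_zero_left]

lemma finrank_range_toEuclideanLin (A : Matrix (Fin a) (Fin b) ℝ) :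
    Module.finrank ℝ (LinearMap.range (Matrix.toEuclideanLin A)) = A.rank := by
  rw [Matrix.rank_eq_finrank_range_toLin A (EuclideanSpace.basisFun _ ℝ).toBasis
    (EuclideanSpace.basisFun _ ℝ).toBasis, ← Matrix.toEuclideanLin_eq_toLin_orthonormal]

/-- A symmetric matrix of rank `k` is bounded below on its range by its `k`-th singular value. -/
lemma sigma_rank_le_norm_mv {A : Matrix (Fin a) (Fin a) ℝ} (hA : A.IsSymm) {k : ℕ}
    (hk : A.rank = k) (y : EuclideanSpace ℝ (Fin a)) :
    sigma A k * ‖mv A y‖ ≤ ‖mv A (mv A y)‖ := by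
  refine singularValues_mul_norm_le (Matrix.toEuclideanLin A)
    (by rw [finrank_range_toEuclideanLin, hk]) fun z hz => ?_
  rw [← mv_eq_toEuclideanLin] at hz
  have h := inner_mv A z y
  rw [hA.eq, hz, inner_zero_left] at h
  exact h.symm

/-- A positive semidefinite matrix with `s ‖x‖ ≤ ‖G x‖` satisfies `s ‖x‖² ≤ ⟪x, G x⟫`. -/
lemma mul_norm_sq_le_inner_of_posSemidef {G : Matrix (Fin a) (Fin a) ℝ} (hG : Gᵀ = G)
    (hpos : ∀ x, 0 ≤ inner ℝ x (mv G x)) {s : ℝ} (h : ∀ x, s * ‖x‖ ≤ ‖mv G x‖)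
    (x : EuclideanSpace ℝ (Fin a)) : s * ‖x‖ ^ 2 ≤ inner ℝ x (mv G x) := by
  have hsymm : (Matrix.toEuclideanLin G).IsSymmetric := fun x y => by
    rw [← mv_eq_toEuclideanLin, ← mv_eq_toEuclideanLin, inner_mv, hG]
  have hn : Module.finrank ℝ (EuclideanSpace ℝ (Fin a)) = a := by simp
  set b := hsymm.eigenvectorBasis hn
  have hb : ∀ i, mv G (b i) = hsymm.eigenvalues hn i • b i := fun i => by
    rw [mv_eq_toEuclideanLin]; exact hsymm.apply_eigenvectorBasis hn i
  have hlam : ∀ i, s ≤ hsymm.eigenvalues hn i := fun i => by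
    have h1 := hpos (b i)
    have h2 := h (b i)
    have hnb : ‖b i‖ = 1 := b.norm_eq_one i
    rw [hb, inner_smul_right, real_inner_self_eq_norm_sq, hnb] at h1
    rw [hb, norm_smul, hnb, Real.norm_eq_abs, abs_of_nonneg (by linarith)] at h2
    linarith
  rw [← b.sum_inner_mul_inner x (mv G x), ← b.sum_sq_inner_right x, Finset.mul_sum]
  refine Finset.sum_le_sum fun i _ => ?_
  have : inner ℝ (b i) (mv G x) = hsymm.eigenvalues hn i * inner ℝ (b i) x := by
    have h3 := inner_mv G (b i) x
    rw [hG] at h3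
    rw [← h3, hb, inner_smul_left]; simp
  rw [this, real_inner_comm]
  nlinarith [hlam i, sq_nonneg (inner ℝ (b i) x)]

end sigma

/-! ### Orthogonal projections as matrices -/

section proj
variable {a n : ℕ}

/-- The matrix of the orthogonal projection onto a subspace. -/
def projMat (V : Submodule ℝ (EuclideanSpace ℝ (Fin n))) : Matrix (Fin n) (Fin n) ℝ :=
  Matrix.toEuclideanLin.symm V.starProjection.toLinearMap

lemma mv_projMat (V : Submodule ℝ (EuclideanSpace ℝ (Fin n))) (x : EuclideanSpace ℝ (Fin n)) :
    mv (projMat V) x = V.starProjection x := by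
  rw [mv_eq_toEuclideanLin, projMat, LinearEquiv.apply_symm_apply]; rfl

lemma ext_mv {A B : Matrix (Fin a) (Fin n) ℝ} (h : ∀ x, mv A x = mv B x) : A = B :=
  Matrix.toEuclideanLin.injective (LinearMap.ext h)

lemma transpose_eq_of_inner {A B : Matrix (Fin n) (Fin n) ℝ}
    (h : ∀ x y, inner ℝ (mv A x) y = inner ℝ x (mv B y)) : Aᵀ = B :=
  ext_mv fun y => ext_inner_left ℝ fun x => by rw [← inner_mv, h]

lemma projMat_transpose (V : Submodule ℝ (EuclideanSpace ℝ (Fin n))) :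
    (projMat V)ᵀ = projMat V :=
  transpose_eq_of_inner fun x y => by
    rw [mv_projMat, mv_projMat, Submodule.inner_starProjection_left_eq_right]

lemma projMat_mul_self (V : Submodule ℝ (EuclideanSpace ℝ (Fin n))) :
    projMat V * projMat V = projMat V :=
  ext_mv fun x => by
    rw [mv_mul, mv_projMat, mv_projMat]
    exact Submodule.starProjection_eq_self_iff.2 (Submodule.starProjection_apply_mem V x)

lemma opNorm_le_one_of_proj {P : Matrix (Fin n) (Fin n) ℝ} (hP : Pᵀ = P) (hPP : P * P = P) :
    ‖P‖ ≤ 1 := by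
  refine opNorm_le_of_mv zero_le_one fun x => ?_
  have h1 : ‖mv P x‖ ^ 2 = inner ℝ x (mv P x) := by
    rw [← real_inner_self_eq_norm_sq, inner_mv, hP, ← mv_mul, hPP]
  have h2 := real_inner_le_norm x (mv P x)
  rcases (norm_nonneg (mv P x)).eq_or_lt' with h | h
  · rw [h]; positivity
  · nlinarith

lemma trace_eq_rank_of_idem {P : Matrix (Fin n) (Fin n) ℝ} (hPP : P * P = P) :
    P.trace = P.rank := by
  have h1 : IsIdempotentElem (Matrix.toLin' P) := by
    rw [IsIdempotentElem, Module.End.mul_eq_comp, ← Matrix.toLin'_mul, hPP]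
  have h2 := (LinearMap.IsIdempotentElem.isProj_range _ h1).trace
  rw [Matrix.trace_toLin'_eq] at h2
  exact h2

lemma frob_mul_proj_sq (A : Matrix (Fin a) (Fin n) ℝ) {P : Matrix (Fin n) (Fin n) ℝ}
    (hP : Pᵀ = P) (hPP : P * P = P) : frob (A * P) ^ 2 = (Aᵀ * A * P).trace := by
  rw [frob_sq, transpose_mul, hP, Matrix.mul_assoc, Matrix.trace_mul_comm, Matrix.mul_assoc Aᵀ,
    Matrix.mul_assoc, Matrix.mul_assoc, hPP]

lemma frob_sub_mul_proj_sq (A : Matrix (Fin a) (Fin n) ℝ) {P : Matrix (Fin n) (Fin n) ℝ}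
    (hP : Pᵀ = P) (hPP : P * P = P) :
    frob (A - A * P) ^ 2 = frob A ^ 2 - frob (A * P) ^ 2 := by
  have h1 : A - A * P = A * (1 - P) := by rw [Matrix.mul_sub, Matrix.mul_one]
  rw [h1, frob_mul_proj_sq A (by rw [transpose_sub, transpose_one, hP])
    (by rw [Matrix.sub_mul, Matrix.mul_sub P, hPP]; simp), frob_mul_proj_sq A hP hPP, frob_sq,
    Matrix.mul_sub, Matrix.mul_one, Matrix.trace_sub]

end proj

/-! ### Perturbation of the best approximation by matrices of bounded rank -/

section rank
variable {n k : ℕ} {X Y : Matrix (Fin n) (Fin n) ℝ}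

/-- `Y` is a Frobenius-nearest matrix to `X` among those of rank at most `k`. -/
def IsBestApprox (k : ℕ) (X Y : Matrix (Fin n) (Fin n) ℝ) : Prop :=
  Y.rank ≤ k ∧ ∀ Z : Matrix (Fin n) (Fin n) ℝ, Z.rank ≤ k → frob (X - Y) ≤ frob (X - Z)

lemma IsBestApprox.transpose (h : IsBestApprox k X Y) : IsBestApprox k Xᵀ Yᵀ := by
  refine ⟨by rw [Matrix.rank_transpose]; exact h.1, fun Z hZ => ?_⟩
  have := h.2 Zᵀ (by rw [Matrix.rank_transpose]; exact hZ)
  rwa [← transpose_sub, frob_transpose, ← frob_transpose (Xᵀ - Z), transpose_sub,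
    transpose_transpose]

/-- A best approximation `Y` of `X` is `X P`, with `P` the projection onto the row space of `Y`. -/
lemma IsBestApprox.exists_proj (h : IsBestApprox k X Y) :
    ∃ P : Matrix (Fin n) (Fin n) ℝ, Pᵀ = P ∧ P * P = P ∧ P.rank ≤ k ∧ Y * P = Y ∧ X * P = Y := by
  set V := (LinearMap.ker (Matrix.toEuclideanLin Y))ᗮ
  have hPt := projMat_transpose V
  have hPP := projMat_mul_self V
  have hYP : Y * projMat V = Y := ext_mv fun x => by
    have h1 : x - V.starProjection x ∈ LinearMap.ker (Matrix.toEuclideanLin Y) := by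
      have := Submodule.sub_starProjection_mem_orthogonal (K := V) x
      rwa [Submodule.orthogonal_orthogonal] at this
    have h2 : mv Y (x - V.starProjection x) = 0 := h1
    rw [mv_mul, mv_projMat]
    rw [mv_sub, sub_eq_zero] at h2
    exact h2.symm
  have hr : (projMat V).rank ≤ Y.rank := by
    rw [← finrank_range_toEuclideanLin, ← finrank_range_toEuclideanLin]
    have h1 : LinearMap.range (Matrix.toEuclideanLin (projMat V)) ≤ V := by
      rintro _ ⟨x, rfl⟩
      rw [← mv_eq_toEuclideanLin, mv_projMat]
      exact Submodule.starProjection_apply_mem V x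
    have h2 := Submodule.finrank_mono h1
    have h3 := Submodule.finrank_add_finrank_orthogonal
      (LinearMap.ker (Matrix.toEuclideanLin Y))
    have h4 := LinearMap.finrank_range_add_finrank_ker (Matrix.toEuclideanLin Y)
    change _ + Module.finrank ℝ V = _ at h3
    omega
  refine ⟨projMat V, hPt, hPP, hr.trans h.1, hYP, ?_⟩
  have h1 := h.2 (X * projMat V) ((Matrix.rank_mul_le_right _ _).trans (hr.trans h.1))
  have h2 := frob_sub_mul_proj_sq (X - Y) hPt hPP
  have h3 : X - Y - (X - Y) * projMat V = X - X * projMat V := by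
    rw [Matrix.sub_mul, hYP]; abel
  rw [h3] at h2
  have h4 : frob ((X - Y) * projMat V) = 0 := by
    have := frob_nonneg (X - Y)
    have := frob_nonneg (X - X * projMat V)
    have h5 := frob_nonneg ((X - Y) * projMat V)
    nlinarith
  have h6 := frob_eq_zero h4
  rwa [Matrix.sub_mul, hYP, sub_eq_zero] at h6

lemma IsBestApprox.frob_mul_proj_le (h : IsBestApprox k X Y) {P P' : Matrix (Fin n) (Fin n) ℝ}
    (hP : Pᵀ = P) (hPP : P * P = P) (hXP : X * P = Y)
    (hP' : P'ᵀ = P') (hPP' : P' * P' = P') (hr : P'.trace ≤ k) :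
    (Xᵀ * X * P').trace ≤ (Xᵀ * X * P).trace := by
  rw [trace_eq_rank_of_idem hPP'] at hr
  have h1 := h.2 (X * P') ((Matrix.rank_mul_le_right _ _).trans (by exact_mod_cast hr))
  rw [← frob_mul_proj_sq X hP hPP, ← frob_mul_proj_sq X hP' hPP']
  have h2 := frob_sub_mul_proj_sq X hP hPP
  have h3 := frob_sub_mul_proj_sq X hP' hPP'
  rw [hXP] at h2 ⊢
  have := pow_le_pow_left₀ (frob_nonneg _) h1 2
  linarith

/-- The rank-one matrix `b bᵀ`. -/
def outer (b : EuclideanSpace ℝ (Fin n)) : Matrix (Fin n) (Fin n) ℝ :=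
  Matrix.vecMulVec b.ofLp b.ofLp

lemma mv_outer (b x : EuclideanSpace ℝ (Fin n)) : mv (outer b) x = (inner ℝ b x : ℝ) • b := by
  ext i
  simp [mv, outer, Matrix.vecMulVec_mulVec, inner_eq_dotProduct]

lemma outer_transpose (b : EuclideanSpace ℝ (Fin n)) : (outer b)ᵀ = outer b := by
  simp [outer, Matrix.transpose_vecMulVec]

lemma trace_mul_outer (A : Matrix (Fin n) (Fin n) ℝ) (b : EuclideanSpace ℝ (Fin n)) :
    (A * outer b).trace = inner ℝ b (mv A b) := by
  simp [outer, Matrix.mul_vecMulVec, Matrix.trace_vecMulVec, inner_eq_dotProduct, mv,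
    dotProduct_comm]

lemma trace_outer (b : EuclideanSpace ℝ (Fin n)) : (outer b).trace = ‖b‖ ^ 2 := by
  have := trace_mul_outer 1 b
  rwa [Matrix.one_mul, mv_one, real_inner_self_eq_norm_sq] at this

lemma trace_transpose_mul_self_mul_outer (A : Matrix (Fin n) (Fin n) ℝ)
    (b : EuclideanSpace ℝ (Fin n)) : (Aᵀ * A * outer b).trace = ‖mv A b‖ ^ 2 := by
  rw [trace_mul_outer, mv_mul, ← inner_mv, real_inner_self_eq_norm_sq]

/-- The residual of a best approximation of rank `k` of `S + Z`, with `S` of rank `k`, is at most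
`‖Z‖`.  For a unit vector `b` in the kernel of `P`, the space `range P + ℝ b` is too large to avoid
the kernel of `S`; if `w` is a unit vector in the intersection, then replacing `P` by
`P + b bᵀ - w wᵀ` cannot improve the approximation, so `‖X b‖ ≤ ‖X w‖ = ‖Z w‖`. -/
lemma IsBestApprox.norm_mv_le {S Z : Matrix (Fin n) (Fin n) ℝ} (h : IsBestApprox k (S + Z) Y)
    (hS : S.rank = k) {P : Matrix (Fin n) (Fin n) ℝ}
    (hP : Pᵀ = P) (hPP : P * P = P) (hPr : P.rank ≤ k) (hXP : (S + Z) * P = Y)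
    {b : EuclideanSpace ℝ (Fin n)} (hb : ‖b‖ = 1) (hPb : mv P b = 0) :
    ‖mv (S + Z) b‖ ≤ ‖Z‖ := by
  have hbP : ∀ x, inner ℝ b (mv P x) = 0 := fun x => by
    have h1 := inner_mv P b x
    rw [hP, hPb, inner_zero_left] at h1
    exact h1.symm
  have hPE : (P + outer b) * (P + outer b) = P + outer b := ext_mv fun x => by
    have h1 : mv P (mv P x) = mv P x := by rw [← mv_mul, hPP]
    simp only [mv_mul, add_mv, mv_add, mv_outer, mv_smul, hPb, hbP, h1, real_inner_self_eq_norm_sq, hb]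
    simp
  have hPEt : (P + outer b)ᵀ = P + outer b := by rw [transpose_add, hP, outer_transpose]
  have htr : (P + outer b).trace = P.rank + 1 := by
    rw [Matrix.trace_add, trace_outer, hb, trace_eq_rank_of_idem hPP]; norm_num
  rcases hPr.lt_or_eq with hlt | heq
  · have h1 := h.frob_mul_proj_le hP hPP hXP hPEt hPE (by rw [htr]; exact_mod_cast hlt)
    rw [Matrix.mul_add, Matrix.trace_add, trace_transpose_mul_self_mul_outer] at h1
    have h2 : ‖mv (S + Z) b‖ ^ 2 = 0 := le_antisymm (by linarith) (sq_nonneg _)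
    rw [sq_eq_zero_iff.1 h2]
    exact norm_nonneg _
  · obtain ⟨w, hw1, hwE, hwS⟩ : ∃ w : EuclideanSpace ℝ (Fin n), ‖w‖ = 1 ∧
        mv (P + outer b) w = w ∧ mv S w = 0 := by
      set A := LinearMap.range (Matrix.toEuclideanLin (P + outer b))
      set B := LinearMap.ker (Matrix.toEuclideanLin S)
      have hA : Module.finrank ℝ A = k + 1 := by
        have h1 := trace_eq_rank_of_idem hPE
        rw [htr, heq] at h1
        rw [finrank_range_toEuclideanLin]
        exact_mod_cast h1.symm
      have hB := LinearMap.finrank_range_add_finrank_ker (Matrix.toEuclideanLin S)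
      rw [finrank_range_toEuclideanLin, hS] at hB
      have hAB := Submodule.finrank_sup_add_finrank_inf_eq A B
      have hle := Submodule.finrank_le (A ⊔ B)
      have hpos : 0 < Module.finrank ℝ (A ⊓ B : Submodule ℝ (EuclideanSpace ℝ (Fin n))) := by
        change _ + Module.finrank ℝ B = _ at hB
        omega
      have hne : A ⊓ B ≠ ⊥ := fun h0 => by rw [h0, finrank_bot] at hpos; omega
      obtain ⟨v, ⟨⟨u, hu⟩, hvB⟩, hv0⟩ := Submodule.exists_mem_ne_zero_of_ne_bot hne
      rw [← mv_eq_toEuclideanLin] at hu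
      refine ⟨(‖v‖⁻¹ : ℝ) • v, norm_smul_inv_norm hv0, ?_, ?_⟩
      · rw [mv_smul, ← hu, ← mv_mul, hPE]
      · rw [mv_smul, show mv S v = 0 from hvB, smul_zero]
    have hwE' : ∀ x, inner ℝ w (mv (P + outer b) x) = inner ℝ w x := fun x => by
      have h1 := inner_mv (P + outer b) w x
      rw [hPEt, hwE] at h1
      exact h1.symm
    have h1 := h.frob_mul_proj_le (P' := P + outer b - outer w) hP hPP hXP
      (by rw [transpose_sub, hPEt, outer_transpose])
      (ext_mv fun x => by
        have h2 : mv (P + outer b) (mv (P + outer b) x) = mv (P + outer b) x := by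
          rw [← mv_mul, hPE]
        rw [mv_mul, sub_mv, sub_mv, mv_sub, mv_sub, h2, mv_outer, mv_smul, hwE, mv_outer,
          mv_smul, mv_outer, hwE', real_inner_self_eq_norm_sq, hw1]
        simp)
      (by rw [Matrix.trace_sub, htr, trace_outer, hw1, heq]; norm_num)
    rw [Matrix.mul_sub, Matrix.mul_add, Matrix.trace_sub, Matrix.trace_add,
      trace_transpose_mul_self_mul_outer, trace_transpose_mul_self_mul_outer] at h1
    have h2 : ‖mv (S + Z) b‖ ≤ ‖mv (S + Z) w‖ :=
      le_of_sq_le_sq (by linarith) (norm_nonneg _)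
    refine h2.trans ?_
    rw [add_mv, hwS, zero_add]
    have := ALMA.norm_mv_le Z w
    rwa [hw1, mul_one] at this

end rank

/-! ### The projection `perpProj` and trace duality -/

section perp
variable {n : ℕ} {S : Matrix (Fin n) (Fin n) ℝ} {σ : ℝ}

lemma perpProj_transpose (S : Matrix (Fin n) (Fin n) ℝ) : (perpProj S)ᵀ = perpProj S :=
  projMat_transpose _

lemma perpProj_mul_self (S : Matrix (Fin n) (Fin n) ℝ) :
    perpProj S * perpProj S = perpProj S :=
  projMat_mul_self _

lemma perpProj_mul (S : Matrix (Fin n) (Fin n) ℝ) : perpProj S * S = 0 :=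
  ext_mv fun x => by
    rw [mv_mul, zero_mv]
    change mv (projMat (LinearMap.range (Matrix.toEuclideanLin S))ᗮ) (mv S x) = 0
    rw [mv_projMat, Submodule.starProjection_apply_eq_zero_iff, Submodule.orthogonal_orthogonal]
    exact ⟨x, rfl⟩

lemma mul_perpProj (hS : Sᵀ = S) : S * perpProj S = 0 := by
  have := congrArg Matrix.transpose (perpProj_mul S)
  rwa [transpose_mul, perpProj_transpose, hS, transpose_zero] at this

lemma sub_perpProj_mem (S : Matrix (Fin n) (Fin n) ℝ) (x : EuclideanSpace ℝ (Fin n)) :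
    ∃ u, mv S u = x - mv (perpProj S) x := by
  have h := Submodule.sub_starProjection_mem_orthogonal
    (K := (LinearMap.range (Matrix.toEuclideanLin S))ᗮ) x
  rw [Submodule.orthogonal_orthogonal] at h
  obtain ⟨u, hu⟩ := h
  refine ⟨u, ?_⟩
  change _ = x - mv (projMat (LinearMap.range (Matrix.toEuclideanLin S))ᗮ) x
  rw [mv_projMat, ← hu]; rfl

lemma one_sub_perpProj_transpose (S : Matrix (Fin n) (Fin n) ℝ) :
    (1 - perpProj S)ᵀ = 1 - perpProj S := by
  rw [transpose_sub, transpose_one, perpProj_transpose]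

lemma one_sub_perpProj_mul_self (S : Matrix (Fin n) (Fin n) ℝ) :
    (1 - perpProj S) * (1 - perpProj S) = 1 - perpProj S := by
  rw [Matrix.sub_mul, Matrix.mul_sub (perpProj S), perpProj_mul_self]; simp

lemma opNorm_perpProj_le (S : Matrix (Fin n) (Fin n) ℝ) : ‖perpProj S‖ ≤ 1 :=
  opNorm_le_one_of_proj (perpProj_transpose S) (perpProj_mul_self S)

lemma opNorm_one_sub_perpProj_le (S : Matrix (Fin n) (Fin n) ℝ) : ‖1 - perpProj S‖ ≤ 1 :=
  opNorm_le_one_of_proj (one_sub_perpProj_transpose S) (one_sub_perpProj_mul_self S)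

lemma rank_one_sub_perpProj (S : Matrix (Fin n) (Fin n) ℝ) : (1 - perpProj S).rank = S.rank := by
  refine le_antisymm ?_ ?_
  · rw [← finrank_range_toEuclideanLin, ← finrank_range_toEuclideanLin]
    refine Submodule.finrank_mono ?_
    rintro _ ⟨x, rfl⟩
    obtain ⟨u, hu⟩ := sub_perpProj_mem S x
    refine ⟨u, ?_⟩
    rw [← mv_eq_toEuclideanLin, ← mv_eq_toEuclideanLin, sub_mv, mv_one, hu]
  · have h : (1 - perpProj S) * S = S := by
      rw [Matrix.sub_mul, perpProj_mul, Matrix.one_mul, sub_zero]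
    calc S.rank = ((1 - perpProj S) * S).rank := by rw [h]
      _ ≤ _ := Matrix.rank_mul_le_left _ _

/-- A vector of the range of a symmetric `S` has a preimage in the range of `S`, and the size of
this preimage is controlled by the lower bound `σ` of `S` on its range. -/
lemma exists_preimage (hS : Sᵀ = S) (hσ : ∀ y, σ * ‖mv S y‖ ≤ ‖mv S (mv S y)‖)
    (x : EuclideanSpace ℝ (Fin n)) :
    ∃ u, mv S u = x - mv (perpProj S) x ∧ σ * ‖u‖ ≤ ‖x - mv (perpProj S) x‖ := by
  obtain ⟨u₀, hu₀⟩ := sub_perpProj_mem S x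
  obtain ⟨u₁, hu₁⟩ := sub_perpProj_mem S u₀
  have h1 : mv S (mv S u₁) = x - mv (perpProj S) x := by
    rw [hu₁, mv_sub, ← mv_mul, mul_perpProj hS, zero_mv, sub_zero, hu₀]
  exact ⟨mv S u₁, h1, by rw [← h1]; exact hσ u₁⟩

lemma mul_norm_le_norm_mv_of_perpProj_eq_zero (hσ : ∀ y, σ * ‖mv S y‖ ≤ ‖mv S (mv S y)‖)
    {x : EuclideanSpace ℝ (Fin n)} (hx : mv (perpProj S) x = 0) : σ * ‖x‖ ≤ ‖mv S x‖ := by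
  obtain ⟨u, hu⟩ := sub_perpProj_mem S x
  rw [hx, sub_zero] at hu
  rw [← hu]; exact hσ u

/-- The Frobenius norm of `1 - perpProj S` is the square root of `rank S`, and `S` stretches every
column of this projection by at least `σ`. -/
lemma rank_mul_sq_le_frob_sq (hS : Sᵀ = S) (hσ0 : 0 ≤ σ) (hσ : ∀ y, σ * ‖mv S y‖ ≤ ‖mv S (mv S y)‖) :
    S.rank * σ ^ 2 ≤ frob S ^ 2 := by
  have h1 : S * (1 - perpProj S) = S := by
    rw [Matrix.mul_sub, mul_perpProj hS, Matrix.mul_one, sub_zero]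
  have h2 : frob (1 - perpProj S) ^ 2 = S.rank := by
    rw [frob_sq, one_sub_perpProj_transpose, one_sub_perpProj_mul_self,
      trace_eq_rank_of_idem (one_sub_perpProj_mul_self S), rank_one_sub_perpProj]
  rw [← h2]
  nth_rw 2 [← h1]
  rw [frob_sq_eq_sum_colv, frob_sq_eq_sum_colv, Finset.sum_mul]
  refine Finset.sum_le_sum fun j _ => ?_
  have h3 : mv (perpProj S) (colv (1 - perpProj S) j) = 0 := by
    rw [← colv_mul, Matrix.mul_sub, perpProj_mul_self, Matrix.mul_one, sub_self]; rfl
  have h4 := mul_norm_le_norm_mv_of_perpProj_eq_zero hσ h3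
  rw [colv_mul, ← mul_pow, mul_comm]
  exact pow_le_pow_left₀ (mul_nonneg hσ0 (norm_nonneg _)) h4 2

end perp

/-- Trace duality between the operator norm and the nuclear norm, the latter being at most
`rank R` times the operator norm. -/
lemma trace_transpose_mul_le_rank {n : ℕ} (B R : Matrix (Fin n) (Fin n) ℝ) :
    (Bᵀ * R).trace ≤ R.rank * (‖B‖ * ‖R‖) := by
  set P := 1 - perpProj R
  have hPR : P * R = R := by
    rw [Matrix.sub_mul, perpProj_mul, Matrix.one_mul, sub_zero]
  have hP : Pᵀ = P := one_sub_perpProj_transpose R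
  have hPP : P * P = P := one_sub_perpProj_mul_self R
  have h1 : (Bᵀ * R).trace = ((P * B)ᵀ * (P * R)).trace := by
    rw [transpose_mul, hP, Matrix.mul_assoc, ← Matrix.mul_assoc P, hPP, hPR]
  have h2 : frob P ^ 2 = R.rank := by
    rw [frob_sq, hP, hPP, trace_eq_rank_of_idem hPP, rank_one_sub_perpProj]
  calc (Bᵀ * R).trace ≤ frob (P * B) * frob (P * R) := by
        rw [h1]; exact trace_transpose_mul_le _ _
    _ ≤ (frob P * ‖B‖) * (frob P * ‖R‖) :=
        mul_le_mul (frob_mul_le' _ _) (frob_mul_le' _ _) (frob_nonneg _)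
          (mul_nonneg (frob_nonneg _) (norm_nonneg _))
    _ = R.rank * (‖B‖ * ‖R‖) := by rw [← h2]; ring

lemma frob_sq_le_rank {n : ℕ} (R : Matrix (Fin n) (Fin n) ℝ) :
    frob R ^ 2 ≤ R.rank * ‖R‖ ^ 2 := by
  rw [frob_sq, pow_two]; exact trace_transpose_mul_le_rank R R

/-! ### Second-order expansion of the rank projection -/

section rank
variable {n k : ℕ} {S Z Y : Matrix (Fin n) (Fin n) ℝ} {σ ζ : ℝ}

lemma rank_add_le (A B : Matrix (Fin n) (Fin n) ℝ) : (A + B).rank ≤ A.rank + B.rank := by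
  simp only [← finrank_range_toEuclideanLin]
  refine (Submodule.finrank_mono ?_).trans (Submodule.finrank_add_le_finrank_add_finrank _ _)
  rintro _ ⟨x, rfl⟩
  rw [map_add]
  exact Submodule.add_mem_sup ⟨x, rfl⟩ ⟨x, rfl⟩

/-- The residual `N` of a best approximation `Y` of `S + Z` satisfies `‖N‖ ≤ ‖Z‖` and `N Yᵀ = 0`. -/
lemma IsBestApprox.residual (h : IsBestApprox k (S + Z) Y) (hS : S.rank = k) :
    ‖S + Z - Y‖ ≤ ‖Z‖ ∧ (S + Z - Y) * Yᵀ = 0 := by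
  obtain ⟨P, hP, hPP, hPr, hYP, hXP⟩ := h.exists_proj
  have hN : S + Z - Y = (S + Z) * (1 - P) := by rw [Matrix.mul_sub, Matrix.mul_one, hXP]
  have hQt : (1 - P)ᵀ = 1 - P := by rw [transpose_sub, transpose_one, hP]
  have hQQ : (1 - P) * (1 - P) = 1 - P := by
    rw [Matrix.sub_mul, Matrix.mul_sub P, hPP]; simp
  have hPQ : P * (1 - P) = 0 := by rw [Matrix.mul_sub, hPP, Matrix.mul_one, sub_self]
  have hQP : (1 - P) * P = 0 := by rw [Matrix.sub_mul, hPP, Matrix.one_mul, sub_self]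
  constructor
  · refine opNorm_le_of_mv (norm_nonneg _) fun x => ?_
    rw [hN, mv_mul]
    set b := mv (1 - P) x
    have hb : ‖b‖ ≤ ‖x‖ := (ALMA.norm_mv_le _ _).trans
      (mul_le_of_le_one_left (norm_nonneg _) (opNorm_le_one_of_proj hQt hQQ))
    have hPb : mv P b = 0 := by rw [← mv_mul, hPQ, zero_mv]
    rcases eq_or_ne b 0 with h0 | h0
    · rw [h0, mv_zero, norm_zero]; positivity
    · have h1 := h.norm_mv_le hS hP hPP hPr hXP (b := (‖b‖⁻¹ : ℝ) • b) (norm_smul_inv_norm h0)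
        (by rw [mv_smul, hPb, smul_zero])
      have hpos : 0 < ‖b‖ := norm_pos_iff.2 h0
      rw [mv_smul, norm_smul, norm_inv, norm_norm, inv_mul_le_iff₀ hpos] at h1
      rw [mul_comm] at h1
      exact h1.trans (mul_le_mul_of_nonneg_left hb (norm_nonneg _))
  · have hYt : Yᵀ = P * Yᵀ := by
      nth_rw 1 [← hYP]; rw [transpose_mul, hP]
    rw [hN, hYt, Matrix.mul_assoc, ← Matrix.mul_assoc (1 - P), hQP, Matrix.zero_mul,
      Matrix.mul_zero]

/-- The residual `N` nearly vanishes on the range of `S`: since `N Yᵀ = 0`, one has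
`N S = N (S - Yᵀ)`, a product of two factors of first order. -/
lemma IsBestApprox.opNorm_residual_mul_le (h : IsBestApprox k (S + Z) Y) (hSt : Sᵀ = S)
    (hZt : Zᵀ = Z) (hSr : S.rank = k) (hσ0 : 0 < σ)
    (hσ : ∀ y, σ * ‖mv S y‖ ≤ ‖mv S (mv S y)‖) (hZ : ‖Z‖ ≤ ζ) :
    ‖(S + Z - Y) * (1 - perpProj S)‖ ≤ 2 * ζ ^ 2 / σ := by
  obtain ⟨h1, h2⟩ := h.residual hSr
  have hζ : 0 ≤ ζ := (norm_nonneg _).trans hZ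
  set N := S + Z - Y with hN
  have hNS : N * S = N * (Nᵀ - Z) := by
    have : Nᵀ - Z = S - Yᵀ := by rw [hN, transpose_sub, transpose_add, hSt, hZt]; abel
    rw [this, Matrix.mul_sub, h2, sub_zero]
  have hNS' : ‖N * S‖ ≤ 2 * ζ ^ 2 := by
    rw [hNS]
    have h3 : ‖Nᵀ - Z‖ ≤ 2 * ζ := by
      have := norm_sub_le Nᵀ Z
      rw [norm_transpose] at this
      linarith
    calc ‖N * (Nᵀ - Z)‖ ≤ ‖N‖ * ‖Nᵀ - Z‖ := Matrix.l2_opNorm_mul _ _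
      _ ≤ ζ * (2 * ζ) := mul_le_mul (h1.trans hZ) h3 (norm_nonneg _) hζ
      _ = _ := by ring
  refine opNorm_le_of_mv (by positivity) fun x => ?_
  obtain ⟨u, hu, hu'⟩ := exists_preimage hSt hσ x
  have h3 : mv (N * (1 - perpProj S)) x = mv (N * S) u := by
    rw [mv_mul N, mv_mul N, hu, sub_mv 1, mv_one]
  have h4 : ‖x - mv (perpProj S) x‖ ≤ ‖x‖ := by
    have := ALMA.norm_mv_le (1 - perpProj S) x
    rw [sub_mv, mv_one] at this
    exact this.trans (mul_le_of_le_one_left (norm_nonneg _) (opNorm_one_sub_perpProj_le S))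
  have h5 : ‖u‖ ≤ ‖x‖ / σ := by rw [le_div_iff₀ hσ0]; linarith
  rw [h3]
  calc ‖mv (N * S) u‖ ≤ ‖N * S‖ * ‖u‖ := ALMA.norm_mv_le _ _
    _ ≤ 2 * ζ ^ 2 * (‖x‖ / σ) := mul_le_mul hNS' h5 (norm_nonneg _) (by positivity)
    _ = _ := by ring

/-- The normal block of a best approximation is of second order.  If `ζ ≤ σ/4`, the range of `S`
is a complement of the kernel of `Y`, so that `Y x = Y u` for some `u` in the range of `S`, and `u`
is small when `x` is in the kernel of `S`. -/
lemma IsBestApprox.opNorm_perpProj_mul_mul_le (h : IsBestApprox k (S + Z) Y) (hSt : Sᵀ = S)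
    (hSr : S.rank = k) (hσ0 : 0 < σ)
    (hσ : ∀ y, σ * ‖mv S y‖ ≤ ‖mv S (mv S y)‖) (hZ : ‖Z‖ ≤ ζ) :
    ‖perpProj S * Y * perpProj S‖ ≤ 8 * ζ ^ 2 / σ := by
  obtain ⟨h1, -⟩ := h.residual hSr
  have hζ : 0 ≤ ζ := (norm_nonneg _).trans hZ
  have hΦ : ‖Y - S‖ ≤ 2 * ζ := by
    have h2 : Y - S = Z - (S + Z - Y) := by abel
    rw [h2]
    have := norm_sub_le Z (S + Z - Y)
    linarith
  set Φ := Y - S with hΦdef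
  set p := perpProj S with hp
  have hpS : p * S = 0 := perpProj_mul S
  have hSp : S * p = 0 := mul_perpProj hSt
  have hpp : p * p = p := perpProj_mul_self S
  have hpn : ‖p‖ ≤ 1 := opNorm_perpProj_le S
  have hqn : ‖1 - p‖ ≤ 1 := opNorm_one_sub_perpProj_le S
  have hpx : ∀ x, ‖mv p x‖ ≤ ‖x‖ := fun x =>
    (ALMA.norm_mv_le _ _).trans (mul_le_of_le_one_left (norm_nonneg _) hpn)
  have hqx : ∀ x, ‖mv (1 - p) x‖ ≤ ‖x‖ := fun x =>
    (ALMA.norm_mv_le _ _).trans (mul_le_of_le_one_left (norm_nonneg _) hqn)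
  have hΦx : ∀ x, ‖mv Φ x‖ ≤ 2 * ζ * ‖x‖ := fun x =>
    (ALMA.norm_mv_le _ _).trans (mul_le_mul_of_nonneg_right hΦ (norm_nonneg _))
  have hYx : ∀ x, mv Y x = mv S x + mv Φ x := fun x => by rw [← add_mv, hΦdef]; congr 1; abel
  have hqS : ∀ x, mv (1 - p) (mv S x) = mv S x := fun x => by
    rw [sub_mv, mv_one, ← mv_mul, hpS, zero_mv, sub_zero]
  have hpS' : ∀ x, mv p (mv S x) = 0 := fun x => by rw [← mv_mul, hpS, zero_mv]
  refine opNorm_le_of_mv (by positivity) fun x => ?_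
  set x' := mv p x
  have hx' : ‖x'‖ ≤ ‖x‖ := hpx x
  have hSx' : mv S x' = 0 := by rw [← mv_mul, hSp, zero_mv]
  rw [Matrix.mul_assoc, mv_mul, mv_mul]
  rcases le_or_gt ζ (σ / 4) with hsmall | hlarge
  · -- on the range of `S`, the map `Y` is bounded below by `σ - 2ζ ≥ σ/2`
    have hlow : ∀ u, mv p u = 0 → σ / 2 * ‖u‖ ≤ ‖mv (1 - p) (mv Y u)‖ := fun u hu => by
      have h2 := mul_norm_le_norm_mv_of_perpProj_eq_zero hσ hu
      have h3 : mv (1 - p) (mv Y u) = mv S u + mv (1 - p) (mv Φ u) := by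
        rw [hYx, mv_add, hqS]
      have h4 := (hqx (mv Φ u)).trans (hΦx u)
      have h5 := norm_sub_le (mv (1 - p) (mv Y u)) (mv (1 - p) (mv Φ u))
      rw [h3, add_sub_cancel_right, ← h3] at h5
      nlinarith [norm_nonneg u]
    obtain ⟨u, hu, huY⟩ : ∃ u, mv p u = 0 ∧ mv Y x' = mv Y u := by
      set A := LinearMap.range (Matrix.toEuclideanLin S)
      set B := LinearMap.ker (Matrix.toEuclideanLin Y)
      have hA : Module.finrank ℝ A = k := by rw [finrank_range_toEuclideanLin, hSr]
      have hB := LinearMap.finrank_range_add_finrank_ker (Matrix.toEuclideanLin Y)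
      rw [finrank_range_toEuclideanLin] at hB
      change _ + Module.finrank ℝ B = _ at hB
      have hAB : A ⊓ B = ⊥ := by
        rw [Submodule.eq_bot_iff]
        rintro _ ⟨⟨w, rfl⟩, hB'⟩
        rw [← mv_eq_toEuclideanLin] at hB' ⊢
        have h2 := hlow (mv S w) (hpS' w)
        rw [show mv Y (mv S w) = 0 from hB', mv_zero, norm_zero] at h2
        have h3 := norm_nonneg (mv S w)
        exact norm_eq_zero.1 (by nlinarith)
      have hdim := Submodule.finrank_sup_add_finrank_inf_eq A B
      rw [hAB, finrank_bot] at hdim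
      have hYr := h.1
      have htop : A ⊔ B = ⊤ := by
        refine Submodule.eq_top_of_finrank_eq (le_antisymm (Submodule.finrank_le _) ?_)
        omega
      obtain ⟨_, ⟨w, rfl⟩, v, hv, huv⟩ := Submodule.mem_sup.1
        (show x' ∈ A ⊔ B by rw [htop]; trivial)
      refine ⟨mv S w, hpS' w, ?_⟩
      rw [← mv_eq_toEuclideanLin] at huv
      rw [← huv, mv_add, show mv Y v = 0 from hv, add_zero]
    have h2 := hlow u hu
    rw [← huY, hYx, hSx', zero_add] at h2
    have h3 := (hqx (mv Φ x')).trans (hΦx x')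
    have h4 : mv p (mv Y x') = mv p (mv Φ u) := by
      rw [huY, hYx, mv_add, hpS', zero_add]
    have h5 := (hpx (mv Φ u)).trans (hΦx u)
    rw [h4, div_mul_eq_mul_div, le_div_iff₀ hσ0]
    have h6 : σ * ‖u‖ ≤ 4 * ζ * ‖x‖ := by nlinarith
    nlinarith
  · -- here `2ζ ≤ 8ζ²/σ`, and the first-order bound suffices
    rw [hYx, hSx', zero_add, div_mul_eq_mul_div, le_div_iff₀ hσ0]
    have h2 := (hpx (mv Φ x')).trans (hΦx x')
    have h3 : ‖mv p (mv Φ x')‖ ≤ 2 * ζ * ‖x‖ := h2.trans (by gcongr)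
    have h4 : 0 ≤ ζ * ‖x‖ := by positivity
    nlinarith

/-- The best approximation of rank `k` of `S + Z` agrees to first order with the projection of
`S + Z` onto the tangent space at `S`. -/
lemma IsBestApprox.opNorm_sub_tangent_le (h : IsBestApprox k (S + Z) Y) (hSt : Sᵀ = S)
    (hZt : Zᵀ = Z) (hSr : S.rank = k) (hσ0 : 0 < σ)
    (hσ : ∀ y, σ * ‖mv S y‖ ≤ ‖mv S (mv S y)‖) (hZ : ‖Z‖ ≤ ζ) :
    ‖Y - (S + Z - perpProj S * (S + Z) * perpProj S)‖ ≤ 12 * ζ ^ 2 / σ := by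
  have h1 := h.opNorm_residual_mul_le hSt hZt hSr hσ0 hσ hZ
  have ht : IsBestApprox k (S + Z) Yᵀ := by
    have := h.transpose
    rwa [transpose_add, hSt, hZt] at this
  have h2 := ht.opNorm_residual_mul_le hSt hZt hSr hσ0 hσ hZ
  have h3 := h.opNorm_perpProj_mul_mul_le hSt hSr hσ0 hσ hZ
  set p := perpProj S with hp
  have h4 : ‖(1 - p) * (S + Z - Y)‖ ≤ 2 * ζ ^ 2 / σ := by
    rw [← norm_transpose, transpose_mul, one_sub_perpProj_transpose, transpose_sub, transpose_add,
      hSt, hZt]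
    exact h2
  have h5 : ‖p * ((S + Z - Y) * (1 - p))‖ ≤ 2 * ζ ^ 2 / σ :=
    (Matrix.l2_opNorm_mul _ _).trans
      ((mul_le_of_le_one_left (norm_nonneg _) (opNorm_perpProj_le S)).trans h1)
  have h6 : Y - (S + Z - p * (S + Z) * p)
      = p * Y * p - (1 - p) * (S + Z - Y) - p * ((S + Z - Y) * (1 - p)) := by
    noncomm_ring
  rw [h6]
  refine (norm_sub_le _ _).trans ((add_le_add (norm_sub_le _ _) le_rfl).trans ?_)
  have h7 : 12 * ζ ^ 2 / σ = 8 * ζ ^ 2 / σ + 2 * ζ ^ 2 / σ + 2 * ζ ^ 2 / σ := by ring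
  rw [h7]
  exact add_le_add (add_le_add h3 h4) h5

lemma IsBestApprox.rank_sub_tangent_le (h : IsBestApprox k (S + Z) Y) (hSr : S.rank = k) :
    (Y - (S + Z - perpProj S * (S + Z) * perpProj S)).rank ≤ 3 * k := by
  set p := perpProj S with hp
  have hr : (1 - p).rank = k := by rw [rank_one_sub_perpProj, hSr]
  have h6 : Y - (S + Z - p * (S + Z) * p)
      = Y + ((1 - p) * (-(S + Z)) + -(p * (S + Z)) * (1 - p)) := by
    noncomm_ring
  rw [h6]
  have h1 := rank_add_le Y ((1 - p) * (-(S + Z)) + -(p * (S + Z)) * (1 - p))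
  have h2 := rank_add_le ((1 - p) * (-(S + Z))) (-(p * (S + Z)) * (1 - p))
  have h3 := Matrix.rank_mul_le_left (1 - p) (-(S + Z))
  have h4 := Matrix.rank_mul_le_right (-(p * (S + Z))) (1 - p)
  have h5 := h.1
  omega

end rank

/-! ### Perturbation of the polar factor -/

section polar
variable {a b : ℕ}

/-- The polar decomposition `F = W H` of an injective matrix, with `W = Π_o(F)`. -/
lemma polar_spec {F : Matrix (Fin a) (Fin b) ℝ} {c : ℝ} (hc : 0 < c)
    (hF : ∀ x, c * ‖x‖ ≤ ‖mv F x‖) :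
    (polar F)ᵀ * polar F = 1 ∧ ∃ H : Matrix (Fin b) (Fin b) ℝ, Hᵀ = H ∧
      (∀ x, 0 ≤ inner ℝ x (mv H x)) ∧ polar F * H = F := by
  set A := Fᴴ * F with hA
  have hAh : A.IsHermitian := Matrix.isHermitian_conjTranspose_mul_self F
  have hsa : IsSelfAdjoint A := hAh.isSelfAdjoint
  have hFt : Fᴴ = Fᵀ := Matrix.conjTranspose_eq_transpose_of_trivial F
  have hspec : ∀ t ∈ spectrum ℝ A, 0 < t := by
    intro t ht
    rw [hAh.spectrum_real_eq_range_eigenvalues] at ht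
    obtain ⟨i, rfl⟩ := ht
    set v := hAh.eigenvectorBasis i
    have hv : ‖v‖ = 1 := hAh.eigenvectorBasis.norm_eq_one i
    have h1 : mv A v = hAh.eigenvalues i • v := by
      have := hAh.mulVec_eigenvectorBasis i
      ext j
      simp only [mv, v, this]
      rfl
    have h2 : ‖mv F v‖ ^ 2 = hAh.eigenvalues i := by
      rw [← real_inner_self_eq_norm_sq, inner_mv, ← mv_mul, ← hFt, h1, inner_smul_right,
        real_inner_self_eq_norm_sq, hv]
      ring
    rw [← h2]
    have := hF v
    rw [hv, mul_one] at this
    exact pow_pos (hc.trans_le this) 2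
  have hcont : ∀ r : ℝ, ContinuousOn (fun t : ℝ => t ^ r) (spectrum ℝ A) := fun r =>
    ContinuousOn.rpow_const continuousOn_id fun t ht => Or.inl (hspec t ht).ne'
  have hmul : ∀ r q : ℝ, cfc (fun t : ℝ => t ^ r) A * cfc (fun t : ℝ => t ^ q) A
      = cfc (fun t : ℝ => t ^ (r + q)) A := fun r q => by
    rw [← cfc_mul _ _ A (hcont r) (hcont q)]
    exact cfc_congr fun t ht => (Real.rpow_add (hspec t ht) r q).symm
  have hone : cfc (fun t : ℝ => t ^ (0 : ℝ)) A = 1 := by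
    simp only [Real.rpow_zero]
    exact cfc_const_one ℝ A
  have hid : cfc (fun t : ℝ => t ^ (1 : ℝ)) A = A := by
    simp only [Real.rpow_one]
    exact cfc_id' ℝ A
  have hsym : ∀ f : ℝ → ℝ, (cfc f A)ᵀ = cfc f A := fun f => by
    have h1 : IsSelfAdjoint (cfc f A) := cfc_predicate f A
    have h2 : (cfc f A)ᴴ = cfc f A := h1
    rwa [Matrix.conjTranspose_eq_transpose_of_trivial] at h2
  have hpolar : polar F = F * cfc (fun t : ℝ => t ^ (-(1 / 2) : ℝ)) A := by
    rw [hAh.cfc_eq]; rfl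
  refine ⟨?_, cfc (fun t : ℝ => t ^ (1 / 2 : ℝ)) A, hsym _, fun x => ?_, ?_⟩
  · rw [hpolar, transpose_mul, hsym, Matrix.mul_assoc, ← Matrix.mul_assoc Fᵀ, ← hFt, ← hA]
    nth_rw 2 [← hid]
    rw [hmul, hmul, ← hone]
    congr 2
    norm_num
  · have h1 : cfc (fun t : ℝ => t ^ (1 / 2 : ℝ)) A
        = cfc (fun t : ℝ => t ^ (1 / 4 : ℝ)) A * cfc (fun t : ℝ => t ^ (1 / 4 : ℝ)) A := by
      rw [hmul]; norm_num
    have h2 := inner_mv (cfc (fun t : ℝ => t ^ (1 / 4 : ℝ)) A) x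
      (mv (cfc (fun t : ℝ => t ^ (1 / 4 : ℝ)) A) x)
    rw [hsym] at h2
    rw [h1, mv_mul, ← h2]
    exact real_inner_self_nonneg
  · rw [hpolar, Matrix.mul_assoc, hmul]
    have h1 : (-(1 / 2) + 1 / 2 : ℝ) = 0 := by norm_num
    rw [h1, hone, Matrix.mul_one]

/-- The skew-symmetric part of a square matrix. -/
def skewPart (X : Matrix (Fin b) (Fin b) ℝ) : Matrix (Fin b) (Fin b) ℝ := (1 / 2 : ℝ) • (X - Xᵀ)

lemma skewPart_transpose (X : Matrix (Fin b) (Fin b) ℝ) : (skewPart X)ᵀ = -skewPart X := by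
  simp only [skewPart, transpose_smul, transpose_sub, transpose_transpose, ← smul_neg, neg_sub]

/-- Two matrices with orthonormal columns differ, to first order, by a matrix `E` with `Vᵀ E`
skew-symmetric. -/
lemma transpose_mul_sub_skewPart {V W : Matrix (Fin a) (Fin b) ℝ} (hV : Vᵀ * V = 1)
    (hW : Wᵀ * W = 1) :
    Vᵀ * (W - V) = skewPart (Vᵀ * (W - V)) + (-(1 / 2) : ℝ) • ((W - V)ᵀ * (W - V)) := by
  have h : (W - V)ᵀ * (W - V) = -(Vᵀ * (W - V)) - (Vᵀ * (W - V))ᵀ := by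
    simp only [transpose_sub, transpose_mul, Matrix.mul_sub, Matrix.sub_mul, hV, hW,
      transpose_transpose, transpose_one]
    abel
  rw [h, skewPart]
  module

lemma frob_transpose_mul_self_le (E : Matrix (Fin a) (Fin b) ℝ) : frob (Eᵀ * E) ≤ frob E ^ 2 := by
  refine (frob_mul_le _ _).trans ?_
  rw [norm_transpose, pow_two]
  exact mul_le_mul_of_nonneg_right (opNorm_le_frob _) (frob_nonneg _)

lemma frob_symmPart_le {V W : Matrix (Fin a) (Fin b) ℝ} :
    frob ((-(1 / 2) : ℝ) • ((W - V)ᵀ * (W - V))) ≤ frob (W - V) ^ 2 / 2 := by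
  rw [frob_smul, abs_neg, abs_of_pos (by norm_num)]
  have := frob_transpose_mul_self_le (W - V)
  linarith

/-- First-order expansion of the polar factor of `V G + V B + N` around `V`, where `V` has
orthonormal columns and `s ≤ G ≤ σ`: the tangential part of the increment is, up to the stated
errors, the skew-symmetric solution `Yp` of the Lyapunov equation `G Yp + Yp G = B - Bᵀ`. -/
lemma polar_expansion {V : Matrix (Fin a) (Fin b) ℝ} (hV : Vᵀ * V = 1)
    {G B Yp : Matrix (Fin b) (Fin b) ℝ} {N : Matrix (Fin a) (Fin b) ℝ} {s σ δ ν : ℝ}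
    (hG : Gᵀ = G) (hs : 0 < s) (hGs : ∀ x, s * ‖x‖ ^ 2 ≤ inner ℝ x (mv G x)) (hGσ : ‖G‖ ≤ σ)
    (hYp : Ypᵀ = -Yp) (hLyap : (G * Yp - B)ᵀ = G * Yp - B)
    (hD : frob (V * B + N) ≤ s * δ) (hN : frob N ≤ s * ν) (hδ : δ ≤ 1 / 20) :
    (polar (V * G + V * B + N))ᵀ * polar (V * G + V * B + N) = 1 ∧
    frob (skewPart (Vᵀ * (polar (V * G + V * B + N) - V)) - Yp)
      ≤ 2 * (σ / s) * δ ^ 2 + ν + 2 * δ ^ 2 ∧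
    frob (polar (V * G + V * B + N) - V
        - V * skewPart (Vᵀ * (polar (V * G + V * B + N) - V))) ≤ 2 * δ ^ 2 + 20 / 19 * ν := by
  set D := V * B + N with hDdef
  set F := V * G + V * B + N with hFdef
  have hFD : F = V * G + D := by rw [hFdef, hDdef, add_assoc]
  have hGlow : ∀ x, s * ‖x‖ ≤ ‖mv G x‖ := fun x => by
    have h1 := (hGs x).trans (real_inner_le_norm _ _)
    rcases (norm_nonneg x).eq_or_lt' with h | h
    · rw [h, mul_zero]; exact norm_nonneg _
    · nlinarith
  have hF : ∀ x, 19 / 20 * s * ‖x‖ ≤ ‖mv F x‖ := fun x => by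
    have h1 : ‖mv (V * G) x‖ = ‖mv G x‖ := by rw [mv_mul, norm_mv_of_isometry hV]
    have h2 := (norm_mv_le_frob D x).trans (mul_le_mul_of_nonneg_right hD (norm_nonneg x))
    have h3 := norm_sub_le (mv F x) (mv D x)
    have h4 : mv F x - mv D x = mv (V * G) x := by rw [hFD, add_mv, add_sub_cancel_right]
    rw [h4, h1] at h3
    have h5 := hGlow x
    have h6 : s * δ * ‖x‖ ≤ s * (1 / 20) * ‖x‖ := by gcongr
    linarith
  obtain ⟨hW, H, hH, hHpos, hWH⟩ := polar_spec (by positivity) hF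
  set W := polar F
  refine ⟨hW, ?_⟩
  set E := W - V with hE
  have hWE : W = V + E := by rw [hE]; abel
  have hsplit := transpose_mul_sub_skewPart hV hW
  have hS := frob_symmPart_le (V := V) (W := W)
  rw [← hE] at hsplit hS
  set Y := skewPart (Vᵀ * E) with hY
  set S := (-(1 / 2) : ℝ) • (Eᵀ * E) with hSdef
  have hYt : Yᵀ = -Y := skewPart_transpose _
  have hSt : Sᵀ = S := by rw [hSdef, transpose_smul, transpose_mul, transpose_transpose]
  have hEV : Eᵀ * V = -Y + S := by
    have := congrArg Matrix.transpose hsplit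
    rwa [transpose_mul, transpose_transpose, transpose_add, hYt, hSt] at this
  have hε0 := frob_nonneg E
  -- `⟪E, W H - V G⟫ = ⟪EᵀE, H + G⟫ / 2` controls the increment
  have hε : frob E ≤ 2 * δ := by
    have key : ∀ C : Matrix (Fin b) (Fin b) ℝ, Cᵀ = C →
        (Vᵀ * E * C).trace = -(1 / 2) * (E * (C * Eᵀ)).trace ∧
        (Eᵀ * V * C).trace = -(1 / 2) * (E * (C * Eᵀ)).trace := fun C hC => by
      have h0 : (Y * C).trace = 0 := by
        have h1 := Matrix.trace_transpose (Y * C)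
        rw [transpose_mul, hC, hYt, Matrix.mul_neg, Matrix.trace_neg, Matrix.trace_mul_comm] at h1
        linarith
      have h1 : (S * C).trace = -(1 / 2) * (E * (C * Eᵀ)).trace := by
        rw [hSdef, Matrix.smul_mul, Matrix.trace_smul, smul_eq_mul, Matrix.mul_assoc,
          Matrix.trace_mul_comm, Matrix.mul_assoc]
      constructor
      · rw [hsplit, Matrix.add_mul, Matrix.trace_add, h0, h1, zero_add]
      · rw [hEV, Matrix.add_mul, Matrix.trace_add, Matrix.neg_mul, Matrix.trace_neg, h0, h1]
        ring
    have hEW : Eᵀ * W = -(Vᵀ * E) := by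
      rw [hE, transpose_sub, Matrix.sub_mul, Matrix.mul_sub, hW, hV]; abel
    have h1 : (Eᵀ * D).trace = 1 / 2 * (E * (H * Eᵀ)).trace + 1 / 2 * (E * (G * Eᵀ)).trace := by
      have h2 : D = W * H - V * G := by rw [hWH, hFD]; abel
      rw [h2, Matrix.mul_sub, ← Matrix.mul_assoc, ← Matrix.mul_assoc, hEW, Matrix.trace_sub,
        Matrix.neg_mul, Matrix.trace_neg, (key H hH).1, (key G hG).2]
      ring
    have h3 := le_trace_transpose_mul_mul (s := 0) (G := H) (fun x => by simpa using hHpos x) Eᵀ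
    have h4 := le_trace_transpose_mul_mul hGs Eᵀ
    rw [transpose_transpose] at h3 h4
    rw [frob_transpose] at h4
    have h5 := trace_transpose_mul_le E D
    have h6 : frob E * frob D ≤ frob E * (s * δ) := mul_le_mul_of_nonneg_left hD hε0
    rcases hε0.eq_or_lt' with h0 | h0
    · have := (frob_nonneg D).trans hD
      have : 0 ≤ δ := nonneg_of_mul_nonneg_right this hs
      linarith
    · have h7 : s * frob E * frob E ≤ s * (2 * δ) * frob E := by nlinarith
      have h8 := le_of_mul_le_mul_right h7 h0
      exact le_of_mul_le_mul_left h8 hs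
  have hε2 : frob E ^ 2 ≤ 4 * δ ^ 2 := by nlinarith
  have hδ0 : 0 ≤ δ := by linarith
  have hS' : frob S ≤ 2 * δ ^ 2 := by linarith
  have hσ0 : 0 ≤ σ := (norm_nonneg _).trans hGσ
  constructor
  · set U := Y - Yp with hU
    have hL : G * U + U * G
        = (S * G - G * S) + (Vᵀ * N - Nᵀ * V) + (Eᵀ * D - Dᵀ * E) := by
      have h1 : H = G + (-Y + S) * G + (B + Vᵀ * N + Eᵀ * D) := by
        have h2 : H = Wᵀ * F := by rw [← hWH, ← Matrix.mul_assoc, hW, Matrix.one_mul]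
        have h3 : Vᵀ * D = B + Vᵀ * N := by
          rw [hDdef, Matrix.mul_add, ← Matrix.mul_assoc, hV, Matrix.one_mul]
        rw [h2, hFD, hWE, transpose_add, Matrix.mul_add, Matrix.add_mul, Matrix.add_mul,
          ← Matrix.mul_assoc, ← Matrix.mul_assoc, hV, Matrix.one_mul, hEV, h3]
      have h2 : G + (-Y + S) * G + (B + Vᵀ * N + Eᵀ * D)
          = G + G * (Y + S) + (Bᵀ + Nᵀ * V + Dᵀ * E) := by
        rw [← h1, ← hH, h1]
        simp only [transpose_add, transpose_mul, transpose_transpose, transpose_neg, hG, hYt, hSt,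
          neg_neg]
      have h3 : -(Yp * G) - Bᵀ = G * Yp - B := by
        rw [← hLyap, transpose_sub, transpose_mul, hG, hYp, Matrix.neg_mul]
      rw [hU, Matrix.mul_sub, Matrix.sub_mul]
      rw [Matrix.add_mul, Matrix.neg_mul, Matrix.mul_add G] at h2
      have h5 : G * Y + Y * G = S * G - G * S + (B - Bᵀ) + (Vᵀ * N - Nᵀ * V)
          + (Eᵀ * D - Dᵀ * E) := by
        have := sub_eq_zero.2 h2
        rw [← sub_eq_zero, ← neg_eq_zero, ← this]
        abel
      have h6 : G * Yp + Yp * G = B - Bᵀ := by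
        have := sub_eq_zero.2 h3
        rw [← sub_eq_zero, ← neg_eq_zero, ← this]
        abel
      calc G * Y - G * Yp + (Y * G - Yp * G) = (G * Y + Y * G) - (G * Yp + Yp * G) := by abel
        _ = _ := by rw [h5, h6]; abel
    have hu0 := frob_nonneg U
    have h1 : 2 * s * frob U ^ 2 ≤ (Uᵀ * (G * U + U * G)).trace := by
      have h2 := le_trace_transpose_mul_mul hGs U
      have h3 := le_trace_transpose_mul_mul hGs Uᵀ
      rw [transpose_transpose, frob_transpose, Matrix.trace_mul_comm, Matrix.mul_assoc,
        Matrix.trace_mul_comm] at h3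
      rw [Matrix.mul_add, Matrix.trace_add, ← Matrix.mul_assoc Uᵀ U]
      linarith
    have h2 : frob (G * U + U * G) ≤ 4 * σ * δ ^ 2 + 2 * (s * ν) + 4 * δ * (s * δ) := by
      rw [hL]
      have b1 : frob (S * G) ≤ 2 * δ ^ 2 * σ :=
        (frob_mul_le' _ _).trans (mul_le_mul hS' hGσ (norm_nonneg _) (by positivity))
      have b2 : frob (G * S) ≤ σ * (2 * δ ^ 2) :=
        (frob_mul_le _ _).trans (mul_le_mul hGσ hS' (frob_nonneg _) hσ0)
      have b3 : frob (Vᵀ * N) ≤ s * ν := (frob_transpose_mul_le_of_isometry hV N).trans hN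
      have b4 : frob (Nᵀ * V) ≤ s * ν := by
        rw [← frob_transpose, transpose_mul, transpose_transpose]; exact b3
      have b5 : frob (Eᵀ * D) ≤ 2 * δ * (s * δ) := by
        refine (frob_mul_le _ _).trans ?_
        rw [norm_transpose]
        exact mul_le_mul ((opNorm_le_frob E).trans hε) hD (frob_nonneg _) (by linarith)
      have b6 : frob (Dᵀ * E) ≤ 2 * δ * (s * δ) := by
        rw [← frob_transpose, transpose_mul, transpose_transpose]; exact b5
      have c1 := frob_sub_le (S * G) (G * S)
      have c2 := frob_sub_le (Vᵀ * N) (Nᵀ * V)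
      have c3 := frob_sub_le (Eᵀ * D) (Dᵀ * E)
      have c4 := frob_add_le (S * G - G * S + (Vᵀ * N - Nᵀ * V)) (Eᵀ * D - Dᵀ * E)
      have c5 := frob_add_le (S * G - G * S) (Vᵀ * N - Nᵀ * V)
      linarith
    have h3 := (h1.trans (trace_transpose_mul_le _ _)).trans (mul_le_mul_of_nonneg_left h2 hu0)
    have h4 : s * (2 * (σ / s) * δ ^ 2 + ν + 2 * δ ^ 2)
        = 1 / 2 * (4 * σ * δ ^ 2 + 2 * (s * ν) + 4 * δ * (s * δ)) := by
      field_simp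
      ring
    rcases hu0.eq_or_lt' with h0 | h0
    · rw [h0]
      have hν : 0 ≤ s * ν := (frob_nonneg _).trans hN
      have : 0 ≤ ν := nonneg_of_mul_nonneg_right hν hs
      positivity
    · refine le_of_mul_le_mul_left ?_ hs
      rw [h4]
      refine le_of_mul_le_mul_right ?_ h0
      nlinarith
  · -- the component of the increment normal to the range of `V` solves `E' H = (1 - V Vᵀ) N`
    set p := 1 - V * Vᵀ with hp
    have hpt : pᵀ = p := by
      rw [hp, transpose_sub, transpose_one, transpose_mul, transpose_transpose]
    have hpV : p * V = 0 := by
      rw [hp, Matrix.sub_mul, Matrix.mul_assoc, hV, Matrix.one_mul, Matrix.mul_one, sub_self]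
    have hpp : p * p = p := by
      nth_rw 2 [hp]
      rw [Matrix.mul_sub, ← Matrix.mul_assoc, hpV, Matrix.zero_mul, Matrix.mul_one, sub_zero]
    have h1 : p * E * H = p * N := by
      have h2 : p * W * H = p * N := by
        rw [Matrix.mul_assoc, hWH, hFdef, Matrix.mul_add, Matrix.mul_add, ← Matrix.mul_assoc,
          ← Matrix.mul_assoc, hpV, Matrix.zero_mul, Matrix.zero_mul, zero_add, zero_add]
      rw [← h2, hWE, Matrix.mul_add, hpV, zero_add]
    have hHlow : ∀ x, 19 / 20 * s * ‖x‖ ≤ ‖mv H x‖ := fun x => by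
      rw [← norm_mv_of_isometry hW (mv H x), ← mv_mul, hWH]; exact hF x
    have h2 : 19 / 20 * s * frob (p * E) ≤ s * ν := by
      have h3 := le_frob_mul (by positivity) hHlow (p * E)ᵀ
      rw [frob_transpose, ← frob_transpose (H * _), transpose_mul, transpose_transpose, hH, h1] at h3
      refine h3.trans ((frob_mul_le _ _).trans ?_)
      exact (mul_le_of_le_one_left (frob_nonneg _) (opNorm_le_one_of_proj hpt hpp)).trans hN
    have h3 : frob (p * E) ≤ 20 / 19 * ν := by
      refine le_of_mul_le_mul_left ?_ hs
      linarith
    have h4 : E - V * Y = V * S + p * E := by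
      have h5 : V * (Vᵀ * E) = V * Y + V * S := by
        nth_rw 1 [hsplit]; rw [Matrix.mul_add]
      rw [hp, Matrix.sub_mul, Matrix.one_mul, Matrix.mul_assoc, h5]
      abel
    rw [h4]
    refine (frob_add_le _ _).trans (add_le_add ?_ h3)
    rw [frob_mul_of_isometry hV]
    exact hS'

end polar

/-! ### Tensor algebra -/

section tensor
variable {a b c d n M : ℕ}

lemma slice_ofSlices (S : Fin d → Matrix (Fin n) (Fin n) ℝ) (m : Fin d) :
    slice (ofSlices S) m = S m := rfl

lemma slice_add (X Y : Tensor d n) (m : Fin d) : slice (X + Y) m = slice X m + slice Y m := rfl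
lemma slice_sub (X Y : Tensor d n) (m : Fin d) : slice (X - Y) m = slice X m - slice Y m := rfl

lemma tensor_ext {X Y : Tensor d n} (h : ∀ m, slice X m = slice Y m) : X = Y := by
  ext ⟨m, i, j⟩
  exact congrFun (congrFun (h m) i) j

/-- The linear combination `∑ l, u_l X(l,:,:)` of the layers. -/
def comb (X : Tensor d n) (u : EuclideanSpace ℝ (Fin d)) : Matrix (Fin n) (Fin n) ℝ :=
  ∑ l, u l • slice X l

lemma slice_mode1 (X : Tensor a n) (A : Matrix (Fin a) (Fin b) ℝ) (j : Fin b) :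
    slice (mode1 X A) j = comb X (colv A j) := rfl

lemma comb_add (X : Tensor d n) (u v : EuclideanSpace ℝ (Fin d)) :
    comb X (u + v) = comb X u + comb X v := by
  simp [comb, add_smul, Finset.sum_add_distrib]

lemma comb_smul (X : Tensor d n) (r : ℝ) (u : EuclideanSpace ℝ (Fin d)) :
    comb X (r • u) = r • comb X u := by
  simp [comb, mul_smul, Finset.smul_sum]

lemma comb_mode1 (X : Tensor a n) (A : Matrix (Fin a) (Fin b) ℝ) (u : EuclideanSpace ℝ (Fin b)) :
    comb (mode1 X A) u = comb X (mv A u) := by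
  simp only [comb, slice_mode1, mv, Matrix.mulVec, dotProduct, Finset.smul_sum, Finset.sum_smul,
    smul_smul, colv]
  rw [Finset.sum_comm]
  simp [mul_comm]

lemma mode1_mode1 (X : Tensor a n) (A : Matrix (Fin a) (Fin b) ℝ) (B : Matrix (Fin b) (Fin c) ℝ) :
    mode1 (mode1 X A) B = mode1 X (A * B) :=
  tensor_ext fun m => by rw [slice_mode1, comb_mode1, slice_mode1, colv_mul]

lemma mode1_add (X : Tensor a n) (A B : Matrix (Fin a) (Fin b) ℝ) :
    mode1 X (A + B) = mode1 X A + mode1 X B :=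
  tensor_ext fun m => by rw [slice_add, slice_mode1, slice_mode1, slice_mode1, ← comb_add]; rfl

lemma mode1_sub (X : Tensor a n) (A B : Matrix (Fin a) (Fin b) ℝ) :
    mode1 X (A - B) = mode1 X A - mode1 X B := by
  rw [eq_sub_iff_add_eq, ← mode1_add, sub_add_cancel]

lemma mode1_smul (X : Tensor a n) (r : ℝ) (A : Matrix (Fin a) (Fin b) ℝ) :
    mode1 X (r • A) = r • mode1 X A :=
  tensor_ext fun m => by
    change _ = r • slice (mode1 X A) m
    rw [slice_mode1, slice_mode1, ← comb_smul]; rfl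

lemma mode1_one (X : Tensor a n) : mode1 X (1 : Matrix (Fin a) (Fin a) ℝ) = X :=
  tensor_ext fun m => by
    simp [slice_mode1, comb, colv, Matrix.one_apply]

lemma add_mode1 (X Y : Tensor a n) (A : Matrix (Fin a) (Fin b) ℝ) :
    mode1 (X + Y) A = mode1 X A + mode1 Y A :=
  tensor_ext fun m => by
    simp [slice_add, slice_mode1, comb, Finset.sum_add_distrib]

lemma inner_eq_sum_trace (X Y : Tensor d n) :
    inner ℝ X Y = ∑ m, ((slice X m)ᵀ * slice Y m).trace := by
  simp only [← inner_vecM]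
  simp [PiLp.inner_apply, Fintype.sum_prod_type, vecM, slice]

lemma norm_sq_eq_sum_frob (X : Tensor d n) : ‖X‖ ^ 2 = ∑ m, frob (slice X m) ^ 2 := by
  rw [← real_inner_self_eq_norm_sq, inner_eq_sum_trace]
  simp only [frob_sq]

lemma mode23_apply (X : Tensor a n) (Y : Tensor b n) (i : Fin a) (k : Fin b) :
    mode23 X Y i k = ((slice X i)ᵀ * slice Y k).trace := by
  rw [← inner_vecM]
  simp [PiLp.inner_apply, Fintype.sum_prod_type, vecM, slice, mode23, mul_comm]

lemma mode23_transpose (X : Tensor a n) (Y : Tensor b n) : (mode23 X Y)ᵀ = mode23 Y X := by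
  ext i k
  simp [mode23, mul_comm]

lemma mode23_add (X : Tensor a n) (Y Z : Tensor b n) :
    mode23 X (Y + Z) = mode23 X Y + mode23 X Z := by
  ext i k
  simp [mode23_apply, slice_add, Matrix.mul_add]

lemma add_mode23 (X Y : Tensor a n) (Z : Tensor b n) :
    mode23 (X + Y) Z = mode23 X Z + mode23 Y Z := by
  ext i k
  simp [mode23_apply, slice_add, Matrix.add_mul]

/-- Duality between contraction with `Y` and linear combination of layers. -/
lemma inner_mv_mode23 (X : Tensor a n) (Y : Tensor b n) (u : EuclideanSpace ℝ (Fin a))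
    (v : EuclideanSpace ℝ (Fin b)) :
    inner ℝ u (mv (mode23 X Y) v) = ((comb X u)ᵀ * comb Y v).trace := by
  simp only [comb, Matrix.transpose_sum, Finset.sum_mul, Matrix.mul_sum,
    Matrix.trace_sum,
    transpose_smul, Matrix.smul_mul, Matrix.mul_smul, Matrix.trace_smul, ← mode23_apply,
    inner_eq_dotProduct, mv, Matrix.mulVec, dotProduct, smul_eq_mul]
  refine Finset.sum_congr rfl fun i _ => ?_
  rw [Finset.mul_sum]
  exact Finset.sum_congr rfl fun k _ => by ring_nf

lemma comb_single (X : Tensor a n) (m : Fin a) : comb X (EuclideanSpace.single m 1) = slice X m := by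
  simp [comb, PiLp.single_apply]

lemma inner_colv_mode23 (X : Tensor a n) (Y : Tensor b n) (u : EuclideanSpace ℝ (Fin a))
    (k : Fin b) : inner ℝ u (colv (mode23 X Y) k) = ((comb X u)ᵀ * slice Y k).trace := by
  rw [colv_eq_mv, inner_mv_mode23, comb_single]

lemma mode23_mode1 (X : Tensor a n) (Y : Tensor b n) (A : Matrix (Fin b) (Fin c) ℝ) :
    mode23 X (mode1 Y A) = mode23 X Y * A :=
  ext_mv fun x => ext_inner_left ℝ fun u => by
    rw [inner_mv_mode23, comb_mode1, mv_mul, inner_mv_mode23]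

lemma mode1_mode23 (X : Tensor a n) (A : Matrix (Fin a) (Fin c) ℝ) (Y : Tensor b n) :
    mode23 (mode1 X A) Y = Aᵀ * mode23 X Y := by
  rw [← mode23_transpose, mode23_mode1, transpose_mul, mode23_transpose]

lemma inner_mode1 (X : Tensor a n) (A : Matrix (Fin a) (Fin b) ℝ) (Y : Tensor b n) :
    inner ℝ (mode1 X A) Y = (Aᵀ * mode23 X Y).trace := by
  rw [← mode1_mode23, inner_eq_sum_trace]
  simp [Matrix.trace, mode23_apply]

lemma norm_mode1_sq (X : Tensor a n) (A : Matrix (Fin a) (Fin b) ℝ) :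
    ‖mode1 X A‖ ^ 2 = (Aᵀ * (mode23 X X * A)).trace := by
  rw [← real_inner_self_eq_norm_sq, inner_mode1, mode23_mode1]

lemma inner_mv_mode23_self (X : Tensor a n) (x : EuclideanSpace ℝ (Fin a)) :
    inner ℝ x (mv (mode23 X X) x) = frob (comb X x) ^ 2 := by
  rw [inner_mv_mode23, frob_sq]

lemma frob_le_sqrt_mul (X : Matrix (Fin a) (Fin b) ℝ) {C : ℝ} (hC : 0 ≤ C)
    (h : ∀ j, ‖colv X j‖ ≤ C) : frob X ≤ √b * C := by
  refine le_of_sq_le_sq ?_ (by positivity)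
  rw [mul_pow, Real.sq_sqrt (Nat.cast_nonneg _), frob_sq_eq_sum_colv]
  calc ∑ j, ‖colv X j‖ ^ 2 ≤ ∑ _j : Fin b, C ^ 2 :=
        Finset.sum_le_sum fun j _ => pow_le_pow_left₀ (norm_nonneg _) (h j) 2
    _ = b * C ^ 2 := by simp

/-! ### The spectral norm of a tensor -/

lemma trilinear_eq (X : Tensor d n) (u : EuclideanSpace ℝ (Fin d)) (v w : EuclideanSpace ℝ (Fin n)) :
    ∑ l, ∑ i, ∑ j, X (l, i, j) * u l * v i * w j = inner ℝ v (mv (comb X u) w) := by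
  simp only [inner_eq_dotProduct, mv, Matrix.mulVec, dotProduct, comb, Matrix.sum_apply,
    Matrix.smul_apply, smul_eq_mul, Finset.mul_sum, Finset.sum_mul, slice, Matrix.of_apply]
  rw [Finset.sum_comm]
  refine Finset.sum_congr rfl fun i _ => ?_
  rw [Finset.sum_comm]
  exact Finset.sum_congr rfl fun j _ => Finset.sum_congr rfl fun l _ => by ring

lemma inner_mv_comb_le_tensorNorm (X : Tensor d n) {u : EuclideanSpace ℝ (Fin d)}
    {v w : EuclideanSpace ℝ (Fin n)} (hu : ‖u‖ = 1) (hv : ‖v‖ = 1) (hw : ‖w‖ = 1) :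
    inner ℝ v (mv (comb X u) w) ≤ tensorNorm X := by
  refine le_csSup ⟨∑ l, ‖slice X l‖, ?_⟩ ⟨u, v, w, hu, hv, hw, (trilinear_eq X u v w).symm⟩
  rintro _ ⟨u, v, w, hu, hv, hw, rfl⟩
  rw [trilinear_eq]
  have h1 := real_inner_le_norm v (mv (comb X u) w)
  have h2 := norm_mv_le (comb X u) w
  rw [hv, one_mul] at h1
  rw [hw, mul_one] at h2
  refine h1.trans (h2.trans ((norm_sum_le _ _).trans (Finset.sum_le_sum fun l _ => ?_)))
  rw [norm_smul]
  refine mul_le_of_le_one_left (norm_nonneg _) ?_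
  rw [← hu]
  exact PiLp.norm_apply_le u l

lemma tensorNorm_nonneg (X : Tensor d n) : 0 ≤ tensorNorm X := by
  by_cases h : ∃ (u : EuclideanSpace ℝ (Fin d)) (v w : EuclideanSpace ℝ (Fin n)),
      ‖u‖ = 1 ∧ ‖v‖ = 1 ∧ ‖w‖ = 1
  · obtain ⟨u, v, w, hu, hv, hw⟩ := h
    have h1 := inner_mv_comb_le_tensorNorm X hu hv hw
    have h2 := inner_mv_comb_le_tensorNorm X hu (by rwa [norm_neg] : ‖-v‖ = 1) hw
    rw [inner_neg_left] at h2
    linarith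
  · refine le_of_eq ?_
    rw [tensorNorm]
    convert Real.sSup_empty.symm
    refine Set.eq_empty_of_forall_notMem ?_
    rintro _ ⟨u, v, w, hu, hv, hw, -⟩
    exact h ⟨u, v, w, hu, hv, hw⟩

lemma opNorm_comb_le (X : Tensor d n) (u : EuclideanSpace ℝ (Fin d)) :
    ‖comb X u‖ ≤ tensorNorm X * ‖u‖ := by
  have hT := tensorNorm_nonneg X
  refine opNorm_le_of_mv (by positivity) fun w => ?_
  rcases eq_or_ne u 0 with hu | hu
  · have : comb X u = 0 := by simp [hu, comb]
    rw [this, zero_mv, norm_zero]; positivity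
  rcases eq_or_ne w 0 with hw | hw
  · rw [hw, mv_zero, norm_zero]; positivity
  rcases eq_or_ne (mv (comb X u) w) 0 with hv | hv
  · rw [hv, norm_zero]; positivity
  set v := mv (comb X u) w
  have h := inner_mv_comb_le_tensorNorm X (u := (‖u‖⁻¹ : ℝ) • u) (v := (‖v‖⁻¹ : ℝ) • v)
    (w := (‖w‖⁻¹ : ℝ) • w) (norm_smul_inv_norm hu) (norm_smul_inv_norm hv) (norm_smul_inv_norm hw)
  have h1 : mv (comb X ((‖u‖⁻¹ : ℝ) • u)) ((‖w‖⁻¹ : ℝ) • w) = (‖u‖⁻¹ * ‖w‖⁻¹ : ℝ) • v := by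
    rw [comb_smul, mv_smul]
    have : mv (‖u‖⁻¹ • comb X u) w = (‖u‖⁻¹ : ℝ) • v := by
      simp [mv, v, Matrix.smul_mulVec]
    rw [this, smul_smul, mul_comm]
  rw [h1, inner_smul_left, inner_smul_right, real_inner_self_eq_norm_sq] at h
  simp only [conj_trivial] at h
  have hu' : 0 < ‖u‖ := norm_pos_iff.2 hu
  have hv' : 0 < ‖v‖ := norm_pos_iff.2 hv
  have hw' : 0 < ‖w‖ := norm_pos_iff.2 hw
  have h2 : ‖v‖⁻¹ * (‖u‖⁻¹ * ‖w‖⁻¹ * ‖v‖ ^ 2) = ‖v‖ / (‖u‖ * ‖w‖) := by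
    field_simp
  rw [h2, div_le_iff₀ (by positivity)] at h
  linarith

/-- Contraction with layers of bounded rank. -/
lemma norm_colv_mode23_le (X : Tensor a n) (Y : Tensor b n) (k : Fin b) :
    ‖colv (mode23 X Y) k‖ ≤ (slice Y k).rank * (tensorNorm X * ‖slice Y k‖) := by
  set y := colv (mode23 X Y) k with hy
  have h1 : ‖y‖ ^ 2 ≤ (slice Y k).rank * (tensorNorm X * ‖slice Y k‖) * ‖y‖ := by
    rw [← real_inner_self_eq_norm_sq]
    nth_rw 2 [hy]
    rw [inner_colv_mode23]
    refine (trace_transpose_mul_le_rank _ _).trans ?_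
    calc (slice Y k).rank * (‖comb X y‖ * ‖slice Y k‖)
        ≤ (slice Y k).rank * (tensorNorm X * ‖y‖ * ‖slice Y k‖) := by
          gcongr; exact opNorm_comb_le X y
      _ = _ := by ring
  rcases (norm_nonneg y).eq_or_lt' with h | h
  · rw [h]; have := tensorNorm_nonneg X; positivity
  · rw [pow_two] at h1
    exact le_of_mul_le_mul_right h1 h

/-! ### The Gram matrix of the layers -/

section gram
variable (Q : Tensor M n)

lemma gram_transpose : (mode23 Q Q)ᵀ = mode23 Q Q := mode23_transpose Q Q

lemma opNorm_gram_le : ‖mode23 Q Q‖ ≤ sigma (mode23 Q Q) 1 :=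
  opNorm_le_of_mv (sigma_nonneg _ _) (norm_mv_le_sigma_one _)

lemma le_inner_gram (x : EuclideanSpace ℝ (Fin M)) :
    sigma (mode23 Q Q) M * ‖x‖ ^ 2 ≤ inner ℝ x (mv (mode23 Q Q) x) :=
  mul_norm_sq_le_inner_of_posSemidef (gram_transpose Q)
    (fun x => by rw [inner_mv_mode23_self]; positivity) (sigma_card_le_norm_mv _) x

lemma inner_gram_le (x : EuclideanSpace ℝ (Fin M)) :
    inner ℝ x (mv (mode23 Q Q) x) ≤ sigma (mode23 Q Q) 1 * ‖x‖ ^ 2 := by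
  refine (real_inner_le_norm _ _).trans ?_
  have := mul_le_mul_of_nonneg_left (norm_mv_le_sigma_one (mode23 Q Q) x) (norm_nonneg x)
  linarith

lemma norm_mode1_sq_le (Y : Matrix (Fin M) (Fin b) ℝ) :
    ‖mode1 Q Y‖ ^ 2 ≤ sigma (mode23 Q Q) 1 * frob Y ^ 2 := by
  rw [norm_mode1_sq]; exact trace_transpose_mul_mul_le (inner_gram_le Q) Y

lemma le_norm_mode1_sq (Y : Matrix (Fin M) (Fin b) ℝ) :
    sigma (mode23 Q Q) M * frob Y ^ 2 ≤ ‖mode1 Q Y‖ ^ 2 := by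
  rw [norm_mode1_sq]; exact le_trace_transpose_mul_mul (le_inner_gram Q) Y

lemma norm_mode1_le (Y : Matrix (Fin M) (Fin b) ℝ) :
    ‖mode1 Q Y‖ ≤ √(sigma (mode23 Q Q) 1) * frob Y := by
  refine le_of_sq_le_sq ?_ (mul_nonneg (Real.sqrt_nonneg _) (frob_nonneg _))
  rw [mul_pow, Real.sq_sqrt (sigma_nonneg _ _)]
  exact norm_mode1_sq_le Q Y

lemma frob_mode23_le (X : Tensor b n) :
    frob (mode23 Q X) ≤ √(sigma (mode23 Q Q) 1) * ‖X‖ := by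
  have h1 : frob (mode23 Q X) ^ 2 ≤ √(sigma (mode23 Q Q) 1) * ‖X‖ * frob (mode23 Q X) := by
    rw [frob_sq, ← inner_mode1]
    refine (real_inner_le_norm _ _).trans ?_
    have := mul_le_mul_of_nonneg_right (norm_mode1_le Q (mode23 Q X)) (norm_nonneg X)
    linarith
  rcases (frob_nonneg (mode23 Q X)).eq_or_lt' with h | h
  · rw [h]; positivity
  · rw [pow_two] at h1
    exact le_of_mul_le_mul_right h1 h

lemma le_frob_slice_sq (m : Fin M) : sigma (mode23 Q Q) M ≤ frob (slice Q m) ^ 2 := by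
  have := le_inner_gram Q (EuclideanSpace.single m 1)
  rw [inner_mv_mode23_self, comb_single] at this
  simpa using this

lemma frob_slice_sq_le (m : Fin M) : frob (slice Q m) ^ 2 ≤ sigma (mode23 Q Q) 1 := by
  have := inner_gram_le Q (EuclideanSpace.single m 1)
  rw [inner_mv_mode23_self, comb_single] at this
  simpa using this

end gram

end tensor

/-! ### The tangent space `L₁` and the contraction factor -/

section tangent

lemma mem_of_norm_starProjection_starProjection {E : Type*} [NormedAddCommGroup E]
    [InnerProductSpace ℝ E] [FiniteDimensional ℝ E] {U V : Submodule ℝ E} {z : E}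
    (h : ‖V.starProjection (U.starProjection z)‖ = ‖z‖) : z ∈ U ∧ z ∈ V := by
  have h1 := V.norm_starProjection_apply_le (U.starProjection z)
  have h2 := U.norm_starProjection_apply_le z
  have hU : z ∈ U := (U.mem_iff_norm_starProjection z).2 (le_antisymm h2 (h ▸ h1))
  rw [Submodule.starProjection_eq_self_iff.2 hU] at h
  exact ⟨hU, (V.mem_iff_norm_starProjection z).2 h⟩

variable {a b c d n M : ℕ} (Q : Tensor M n)

/-- The projection onto `L₁` acts layerwise. -/
lemma slice_starProjection_L1 (X : Tensor M n) (m : Fin M) :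
    slice ((L1 Q).starProjection X) m
      = slice X m - perpProj (slice Q m) * slice X m * perpProj (slice Q m) := by
  have h : (L1 Q).starProjection X = ofSlices fun m =>
      slice X m - perpProj (slice Q m) * slice X m * perpProj (slice Q m) := by
    refine Submodule.eq_starProjection_of_mem_of_inner_eq_zero ?_ ?_
    · intro m
      rw [slice_ofSlices]
      have hp := perpProj_mul_self (slice Q m)
      set p := perpProj (slice Q m)
      calc p * (slice X m - p * slice X m * p) * p
          = p * slice X m * p - (p * p) * slice X m * (p * p) := by noncomm_ring
        _ = 0 := by rw [hp, sub_self]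
    · intro Y hY
      rw [inner_eq_sum_trace]
      refine Finset.sum_eq_zero fun m _ => ?_
      rw [slice_sub, slice_ofSlices, sub_sub_cancel]
      have hp := perpProj_transpose (slice Q m)
      have hYm := hY m
      set p := perpProj (slice Q m)
      rw [transpose_mul, transpose_mul, hp, Matrix.mul_assoc, Matrix.trace_mul_comm,
        Matrix.mul_assoc, Matrix.mul_assoc, ← Matrix.mul_assoc p, hYm, Matrix.mul_zero,
        Matrix.trace_zero]
  rw [h, slice_ofSlices]

lemma starProjection_L1_self : (L1 Q).starProjection Q = Q := by
  refine Submodule.starProjection_eq_self_iff.2 fun m => ?_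
  rw [perpProj_mul, Matrix.zero_mul]

lemma slice_tangentProj (m : Fin M) (X : Tensor d n) (l : Fin d) :
    slice (tangentProj Q m X) l
      = slice X l - perpProj (slice Q m) * slice X l * perpProj (slice Q m) := rfl

lemma comb_tangentProj (m : Fin M) (X : Tensor d n) (u : EuclideanSpace ℝ (Fin d)) :
    comb (tangentProj Q m X) u
      = comb X u - perpProj (slice Q m) * comb X u * perpProj (slice Q m) := by
  simp only [comb, slice_tangentProj, smul_sub, Finset.sum_sub_distrib, Matrix.mul_sum,
    Matrix.sum_mul, Matrix.mul_smul, Matrix.smul_mul]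

/-- Contraction of `X` with a tangent tensor only involves the tangential part of `X`. -/
lemma colv_mode23_starProjection_L1 (X : Tensor a n) (Z : Tensor c n)
    (A : Matrix (Fin c) (Fin M) ℝ) (m : Fin M) :
    colv (mode23 X ((L1 Q).starProjection (mode1 Z A))) m
      = mv (mode23 (tangentProj Q m X) (tangentProj Q m Z)) (colv A m) := by
  refine ext_inner_left ℝ fun u => ?_
  rw [inner_colv_mode23, slice_starProjection_L1, slice_mode1, inner_mv_mode23, comb_tangentProj,
    comb_tangentProj]
  have hp := perpProj_transpose (slice Q m)
  have hpp := perpProj_mul_self (slice Q m)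
  set p := perpProj (slice Q m)
  set A' := comb X u
  set B' := comb Z (colv A m)
  have h1 : ((p * A' * p)ᵀ * (B' - p * B' * p)).trace = 0 := by
    have h2 : (p * A' * p)ᵀ * (B' - p * B' * p) = p * (A'ᵀ * p * (B' - p * B' * p)) := by
      rw [transpose_mul, transpose_mul, hp]; simp only [Matrix.mul_assoc]
    have h3 : p * (B' - p * B' * p) * p = 0 := by
      calc p * (B' - p * B' * p) * p = p * B' * p - (p * p) * B' * (p * p) := by noncomm_ring
        _ = 0 := by rw [hpp, sub_self]
    rw [h2, Matrix.trace_mul_comm, Matrix.mul_assoc, Matrix.mul_assoc, ← Matrix.mul_assoc p, h3,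
      Matrix.mul_zero, Matrix.trace_zero]
  rw [transpose_sub, Matrix.sub_mul, Matrix.trace_sub, h1, sub_zero]

lemma norm_proj_proj_le (X : Tensor M n) :
    ‖(L2 Q).starProjection ((L1 Q).starProjection X)‖ ≤ ‖X‖ :=
  (Submodule.norm_starProjection_apply_le _ _).trans (Submodule.norm_starProjection_apply_le _ _)

lemma norm_proj_proj_le_kappaH (X : Tensor M n) :
    ‖(L2 Q).starProjection ((L1 Q).starProjection X)‖ ≤ kappaH Q * ‖X‖ := by
  rcases eq_or_ne X 0 with rfl | hX
  · simp
  have hpos : 0 < ‖X‖ := norm_pos_iff.2 hX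
  rw [← div_le_iff₀ hpos]
  refine le_csSup ⟨1, ?_⟩ ⟨X, hX, rfl⟩
  rintro _ ⟨Y, hY, rfl⟩
  exact div_le_one_of_le₀ (norm_proj_proj_le Q Y) (norm_nonneg _)

lemma kappaH_nonneg : 0 ≤ kappaH Q := by
  refine Real.sSup_nonneg ?_
  rintro _ ⟨X, -, rfl⟩
  positivity

/-- By compactness of the unit sphere, `κ_H < 1` as soon as `L₁ ∩ L₂ = {0}`. -/
lemma kappaH_lt_one (h : L1 Q ⊓ L2 Q = ⊥) : kappaH Q < 1 := by
  by_cases hne : ∃ X : Tensor M n, X ≠ 0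
  · obtain ⟨X₀, hX₀⟩ := hne
    have hcont : Continuous fun X : Tensor M n =>
        ‖(L2 Q).starProjection ((L1 Q).starProjection X)‖ := by fun_prop
    obtain ⟨Z, hZ, hmax⟩ := (isCompact_sphere (0 : Tensor M n) 1).exists_isMaxOn
      ⟨(‖X₀‖⁻¹ : ℝ) • X₀, by simp [norm_smul, hX₀]⟩ hcont.continuousOn
    have hZ1 : ‖Z‖ = 1 := by simpa using hZ
    have hlt : ‖(L2 Q).starProjection ((L1 Q).starProjection Z)‖ < 1 := by
      refine lt_of_le_of_ne ((norm_proj_proj_le Q Z).trans_eq hZ1) fun heq => ?_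
      have h6 : Z ∈ L1 Q ⊓ L2 Q :=
        mem_of_norm_starProjection_starProjection (heq.trans hZ1.symm)
      rw [h, Submodule.mem_bot] at h6
      rw [h6, norm_zero] at hZ1
      exact zero_ne_one hZ1
    refine lt_of_le_of_lt (csSup_le ⟨_, X₀, hX₀, rfl⟩ ?_) hlt
    rintro _ ⟨X, hX, rfl⟩
    have h1 := hmax (show (‖X‖⁻¹ : ℝ) • X ∈ Metric.sphere (0 : Tensor M n) 1 by
      simp [norm_smul, hX])
    simp only [Set.mem_ofPred_eq, map_smul, norm_smul, norm_inv, norm_norm] at h1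
    rwa [div_eq_inv_mul]
  · have : {r | ∃ X : Tensor M n, X ≠ 0 ∧
        r = ‖(L2 Q).starProjection ((L1 Q).starProjection X)‖ / ‖X‖} = ∅ :=
      Set.eq_empty_of_forall_notMem fun r ⟨X, hX, _⟩ => hne ⟨X, hX⟩
    rw [kappaH, this, Real.sSup_empty]
    exact zero_lt_one

/-- `P_{L₂} X = Q ×₁ Y` for a skew-symmetric solution `Y` of the Lyapunov equation
`G Y + Y G = B - Bᵀ` with `B = Q ×₂₃ X`. -/
lemma exists_skew_starProjection_L2 (X : Tensor M n) :
    ∃ Y : Matrix (Fin M) (Fin M) ℝ, Yᵀ = -Y ∧ (L2 Q).starProjection X = mode1 Q Y ∧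
      (mode23 Q Q * Y - mode23 Q X)ᵀ = mode23 Q Q * Y - mode23 Q X := by
  obtain ⟨Y, hY, hYX⟩ := Submodule.starProjection_apply_mem (L2 Q) X
  refine ⟨Y, hY, hYX, ?_⟩
  set C := mode23 Q Q * Y - mode23 Q X with hC
  have h : ∀ V : Matrix (Fin M) (Fin M) ℝ, Vᵀ = -V → (Vᵀ * C).trace = 0 := fun V hV => by
    have h1 := Submodule.starProjection_inner_eq_zero (K := L2 Q) X (mode1 Q V) ⟨V, hV, rfl⟩
    rw [hYX, real_inner_comm, inner_sub_right, inner_mode1, inner_mode1, mode23_mode1] at h1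
    rw [hC, Matrix.mul_sub, Matrix.trace_sub]
    linarith
  clear_value C
  -- test with `V = C - Cᵀ`
  have h1 := h (C - Cᵀ) (by rw [transpose_sub, transpose_transpose, neg_sub])
  have h2 : frob (C - Cᵀ) ^ 2 = 2 * ((C - Cᵀ)ᵀ * C).trace := by
    rw [frob_sq, Matrix.mul_sub, Matrix.trace_sub]
    have h3 : ((C - Cᵀ)ᵀ * Cᵀ).trace = -((C - Cᵀ)ᵀ * C).trace := by
      rw [← Matrix.trace_transpose, transpose_mul, transpose_transpose, transpose_transpose,
        Matrix.trace_mul_comm, transpose_sub, transpose_transpose, ← Matrix.trace_neg,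
        ← Matrix.neg_mul, neg_sub]
    rw [h3]; ring
  rw [h1, mul_zero] at h2
  have h3 := frob_eq_zero (pow_eq_zero_iff two_ne_zero |>.1 h2)
  exact (sub_eq_zero.1 h3).symm

end tangent

/-! ### The weighted metric -/

section metric
variable {n L M : ℕ} (Q : Tensor M n)

lemma skewValues_nonempty (hM : 2 ≤ M) : (skewValues Q).Nonempty := by
  obtain ⟨i, j, hij⟩ : ∃ i j : Fin M, i ≠ j :=
    ⟨⟨0, by omega⟩, ⟨1, by omega⟩, by simp⟩
  set Y : Matrix (Fin M) (Fin M) ℝ := skewPart (Matrix.single i j 1)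
  have hY0 : Y ≠ 0 := fun h => by
    have := congrFun (congrFun h i) j
    simp [Y, skewPart, Matrix.single, hij, hij.symm] at this
  have hf : frob Y ≠ 0 := fun h => hY0 (frob_eq_zero h)
  refine ⟨_, (frob Y)⁻¹ • Y, ?_, ?_, rfl⟩
  · rw [transpose_smul, skewPart_transpose, smul_neg]
  · rw [frob_smul, abs_inv, abs_of_nonneg (frob_nonneg _), inv_mul_cancel₀ hf]

lemma le_of_mem_skewValues {r : ℝ} (hr : r ∈ skewValues Q) :
    √(sigma (mode23 Q Q) M) ≤ r := by
  obtain ⟨Y, -, hY, rfl⟩ := hr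
  refine Real.sqrt_le_iff.2 ⟨norm_nonneg _, ?_⟩
  simpa [hY] using le_norm_mode1_sq Q Y

lemma bddBelow_skewValues : BddBelow (skewValues Q) := ⟨_, fun _ h => le_of_mem_skewValues Q h⟩

lemma bddAbove_skewValues : BddAbove (skewValues Q) := by
  refine ⟨√(sigma (mode23 Q Q) 1), ?_⟩
  rintro _ ⟨Y, -, hY, rfl⟩
  simpa [hY] using norm_mode1_le Q Y

lemma sInf_skewValues_pos (hM : 2 ≤ M) (hκ : 0 < sigma (mode23 Q Q) M) :
    0 < sInf (skewValues Q) :=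
  (Real.sqrt_pos.2 hκ).trans_le
    (le_csInf (skewValues_nonempty Q hM) fun _ h => le_of_mem_skewValues Q h)

lemma one_le_CH (hM : 2 ≤ M) (hκ : 0 < sigma (mode23 Q Q) M) : 1 ≤ CH Q := by
  rw [CH, one_le_div (sInf_skewValues_pos Q hM hκ)]
  exact csInf_le_csSup (skewValues_nonempty Q hM) (bddBelow_skewValues Q) (bddAbove_skewValues Q)

lemma norm_mode1_skew_mem {Y : Matrix (Fin M) (Fin M) ℝ} (hY : Yᵀ = -Y) (h : frob Y ≠ 0) :
    ‖mode1 Q Y‖ / frob Y ∈ skewValues Q := by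
  refine ⟨(frob Y)⁻¹ • Y, by rw [transpose_smul, hY, smul_neg], ?_, ?_⟩
  · rw [frob_smul, abs_inv, abs_of_nonneg (frob_nonneg _), inv_mul_cancel₀ h]
  · rw [mode1_smul, norm_smul, norm_inv, Real.norm_eq_abs, abs_of_nonneg (frob_nonneg _),
      div_eq_inv_mul]

lemma sInf_skewValues_mul_frob_le {Y : Matrix (Fin M) (Fin M) ℝ} (hY : Yᵀ = -Y) :
    sInf (skewValues Q) * frob Y ≤ ‖mode1 Q Y‖ := by
  rcases (frob_nonneg Y).eq_or_lt' with h | h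
  · rw [h, mul_zero]; exact norm_nonneg _
  · rw [← le_div_iff₀ h]
    exact csInf_le (bddBelow_skewValues Q) (norm_mode1_skew_mem Q hY h.ne')

lemma norm_mode1_le_sSup_skewValues {Y : Matrix (Fin M) (Fin M) ℝ} (hY : Yᵀ = -Y) :
    ‖mode1 Q Y‖ ≤ sSup (skewValues Q) * frob Y := by
  rcases (frob_nonneg Y).eq_or_lt' with h | h
  · rw [h, frob_eq_zero h]
    have : mode1 Q (0 : Matrix (Fin M) (Fin M) ℝ) = 0 := by
      have := mode1_smul Q 0 (0 : Matrix (Fin M) (Fin M) ℝ); simpa using this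
    rw [this]; simp
  · rw [← div_le_iff₀ h]
    exact le_csSup (bddAbove_skewValues Q) (norm_mode1_skew_mem Q hY h.ne')

/-- The projection of `E` onto `L₀` is `W_*` times the skew-symmetric part of `W_*ᵀ E`. -/
lemma starProjection_L0 {V : Matrix (Fin L) (Fin M) ℝ} (hV : Vᵀ * V = 1)
    (E : Matrix (Fin L) (Fin M) ℝ) :
    (L0 V).starProjection (vecM E) = vecM (V * skewPart (Vᵀ * E)) := by
  refine Submodule.eq_starProjection_of_mem_of_inner_eq_zero
    ⟨skewPart (Vᵀ * E), skewPart_transpose _, rfl⟩ ?_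
  rintro _ ⟨Y, hY, rfl⟩
  rw [← vecM_sub, real_inner_comm, inner_vecM, transpose_mul, Matrix.mul_assoc, Matrix.mul_sub,
    ← Matrix.mul_assoc, hV, Matrix.one_mul, hY]
  set X := Vᵀ * E
  have h1 : X - skewPart X = (1 / 2 : ℝ) • (X + Xᵀ) := by rw [skewPart]; module
  have h2 : (-Y * (X + Xᵀ)).trace = 0 := by
    have h3 := Matrix.trace_transpose (-Y * (X + Xᵀ))
    rw [transpose_mul, transpose_add, transpose_transpose, transpose_neg, hY, neg_neg,
      Matrix.trace_mul_comm, add_comm Xᵀ, Matrix.neg_mul, Matrix.trace_neg] at h3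
    rw [Matrix.neg_mul, Matrix.trace_neg]
    linarith
  rw [h1, Matrix.mul_smul, Matrix.trace_smul, h2, smul_zero]

lemma mode1_trueTensor (V : Matrix (Fin L) (Fin M) ℝ) {k : ℕ} (W : Matrix (Fin L) (Fin k) ℝ) :
    mode1 (trueTensor Q V) W = mode1 Q (Vᵀ * W) := mode1_mode1 _ _ _

lemma mode23_trueTensor (V : Matrix (Fin L) (Fin M) ℝ) {k : ℕ} (Y : Tensor k n) :
    mode23 (trueTensor Q V) Y = V * mode23 Q Y := by
  rw [trueTensor, mode1_mode23, transpose_transpose]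

lemma dNorm_eq {V : Matrix (Fin L) (Fin M) ℝ} (hV : Vᵀ * V = 1) (E : Matrix (Fin L) (Fin M) ℝ) :
    dNorm Q V E = √(((sInf (skewValues Q))⁻¹ * ‖mode1 Q (skewPart (Vᵀ * E))‖) ^ 2
      + frob (E - V * skewPart (Vᵀ * E)) ^ 2) := by
  have h1 : (L0 V)ᗮ.starProjection (vecM E) = vecM (E - V * skewPart (Vᵀ * E)) := by
    have := Submodule.starProjection_orthogonal_val (K := L0 V) (vecM E)
    rw [vecM_sub, ← starProjection_L0 hV, ← this]
  have h2 : unvecM (vecM (V * skewPart (Vᵀ * E))) = V * skewPart (Vᵀ * E) := rfl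
  rw [dNorm, h1, starProjection_L0 hV, h2, mode1_trueTensor, ← Matrix.mul_assoc, hV,
    Matrix.one_mul]
  rfl

lemma dNorm_nonneg (V E : Matrix (Fin L) (Fin M) ℝ) : 0 ≤ dNorm Q V E := Real.sqrt_nonneg _

lemma dNorm_le_add {V : Matrix (Fin L) (Fin M) ℝ} (hV : Vᵀ * V = 1) (hM : 2 ≤ M)
    (hκ : 0 < sigma (mode23 Q Q) M) (E : Matrix (Fin L) (Fin M) ℝ) :
    dNorm Q V E ≤ (sInf (skewValues Q))⁻¹ * ‖mode1 Q (skewPart (Vᵀ * E))‖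
      + frob (E - V * skewPart (Vᵀ * E)) := by
  have h1 := inv_pos.2 (sInf_skewValues_pos Q hM hκ)
  have h2 := frob_nonneg (E - V * skewPart (Vᵀ * E))
  rw [dNorm_eq Q hV]
  refine Real.sqrt_le_iff.2 ⟨by positivity, ?_⟩
  have h3 : 0 ≤ (sInf (skewValues Q))⁻¹ * ‖mode1 Q (skewPart (Vᵀ * E))‖ := by positivity
  nlinarith

lemma le_dNorm {V : Matrix (Fin L) (Fin M) ℝ} (hV : Vᵀ * V = 1) (E : Matrix (Fin L) (Fin M) ℝ) :
    (sInf (skewValues Q))⁻¹ * ‖mode1 Q (skewPart (Vᵀ * E))‖ ≤ dNorm Q V E := by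
  rw [dNorm_eq Q hV]
  exact Real.le_sqrt_of_sq_le (le_add_of_nonneg_right (sq_nonneg _))

lemma frob_le_dNorm {V : Matrix (Fin L) (Fin M) ℝ} (hV : Vᵀ * V = 1) (hM : 2 ≤ M)
    (hκ : 0 < sigma (mode23 Q Q) M) (E : Matrix (Fin L) (Fin M) ℝ) :
    frob E ≤ dNorm Q V E := by
  have hpos := sInf_skewValues_pos Q hM hκ
  have h1 := sInf_skewValues_mul_frob_le Q (skewPart_transpose (Vᵀ * E))
  have h2 : frob (skewPart (Vᵀ * E)) ≤
      (sInf (skewValues Q))⁻¹ * ‖mode1 Q (skewPart (Vᵀ * E))‖ := by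
    rw [inv_mul_eq_div, le_div_iff₀ hpos]; linarith
  rw [dNorm_eq Q hV]
  refine Real.le_sqrt_of_sq_le ?_
  have h3 := (L0 V).norm_sq_eq_add_norm_sq_starProjection (vecM E)
  rw [Submodule.starProjection_orthogonal_val, starProjection_L0 hV, ← vecM_sub] at h3
  change frob E ^ 2 = frob _ ^ 2 + frob _ ^ 2 at h3
  rw [h3, frob_mul_of_isometry hV]
  have h4 := pow_le_pow_left₀ (frob_nonneg _) h2 2
  linarith

end metric

/-! ### Sizes of the layers of the true tensor -/

section layers
variable {n M : ℕ} {K : Fin M → ℕ} {Q : Tensor M n}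

lemma sigmaMin_le (m : Fin M) : sigmaMin K Q ≤ sigma (slice Q m) (K m) :=
  ciInf_le (Set.finite_range _).bddBelow m

lemma sigmaMin_pos (hM : 2 ≤ M) (hrank : ∀ m, (slice Q m).rank = K m)
    (hκ : 0 < sigma (mode23 Q Q) M) : 0 < sigmaMin K Q := by
  have : Nonempty (Fin M) := ⟨⟨0, by omega⟩⟩
  obtain ⟨m, hm⟩ := exists_eq_ciInf_of_finite (f := fun m => sigma (slice Q m) (K m))
  rw [sigmaMin, ← hm]
  refine (LinearMap.singularValues_pos_iff_lt_finrank_range _).2 ?_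
  rw [finrank_range_toEuclideanLin, hrank]
  have h1 := frob_sq_le_rank (slice Q m)
  have h2 := le_frob_slice_sq Q m
  rcases Nat.eq_zero_or_pos (K m) with h | h
  · rw [hrank, h] at h1
    simp only [Nat.cast_zero, zero_mul] at h1
    linarith
  · omega

lemma sigmaMin_mul_norm_le (hsymm : ∀ m, (slice Q m).IsSymm)
    (hrank : ∀ m, (slice Q m).rank = K m) (m : Fin M) (y : EuclideanSpace ℝ (Fin n)) :
    sigmaMin K Q * ‖mv (slice Q m) y‖ ≤ ‖mv (slice Q m) (mv (slice Q m) y)‖ :=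
  (mul_le_mul_of_nonneg_right (sigmaMin_le m) (norm_nonneg _)).trans
    (sigma_rank_le_norm_mv (hsymm m) (hrank m) y)

lemma card_mul_sigmaMin_sq_le (hM : 2 ≤ M) (hsymm : ∀ m, (slice Q m).IsSymm)
    (hrank : ∀ m, (slice Q m).rank = K m) (hκ : 0 < sigma (mode23 Q Q) M) (m : Fin M) :
    K m * sigmaMin K Q ^ 2 ≤ sigma (mode23 Q Q) 1 := by
  have h := rank_mul_sq_le_frob_sq (hsymm m) (sigmaMin_pos hM hrank hκ).le
    (sigmaMin_mul_norm_le hsymm hrank m)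
  rw [hrank] at h
  exact h.trans (frob_slice_sq_le Q m)

lemma opNorm_slice_le (m : Fin M) : ‖slice Q m‖ ≤ tensorNorm Q := by
  have := opNorm_comb_le Q (EuclideanSpace.single m 1)
  rw [comb_single] at this
  simpa using this

/-- The spectral norm of `Q` is bounded below in terms of its average layer rank. -/
lemma card_mul_sigma_le (hrank : ∀ m, (slice Q m).rank = K m) :
    M * sigma (mode23 Q Q) M ≤ (∑ m, (K m : ℝ)) * tensorNorm Q ^ 2 := by
  rw [Finset.sum_mul]
  calc (M : ℝ) * sigma (mode23 Q Q) M = ∑ _m : Fin M, sigma (mode23 Q Q) M := by simp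
    _ ≤ _ := Finset.sum_le_sum fun m _ => (le_frob_slice_sq Q m).trans ?_
  have h1 := frob_sq_le_rank (slice Q m)
  rw [hrank] at h1
  refine h1.trans ?_
  have := opNorm_slice_le (Q := Q) m
  gcongr

lemma one_le_kappa0 (hM : 2 ≤ M) (hκ : 0 < sigma (mode23 Q Q) M) : 1 ≤ kappa0 Q := by
  rw [kappa0, one_le_div hκ]
  exact LinearMap.singularValues_antitone _ (Nat.sub_le_sub_right (by omega) 1)

end layers

/-! ### The error of the rank projection -/

section remainder
variable {n L M : ℕ} {K : Fin M → ℕ} {Q : Tensor M n} {Δ : Tensor L n}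

/-- Contraction of `A = P_* + Δ` with a tensor whose layers have small rank and operator norm.
The part of `P_*` is estimated in Frobenius norm, that of `Δ` by trace duality. -/
lemma frob_mode23_remainder_le (hM : 2 ≤ M) (hsymm : ∀ m, (slice Q m).IsSymm)
    (hrank : ∀ m, (slice Q m).rank = K m) (hκ : 0 < sigma (mode23 Q Q) M)
    (hΔ : tensorNorm Δ ≤ 1 / 4 * sigmaMin K Q) {Y : Tensor M n} {r : ℝ}
    (hYr : ∀ m, (slice Y m).rank ≤ 3 * K m) (hYn : ∀ m, ‖slice Y m‖ ≤ r) :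
    frob (mode23 Q Y) + frob (mode23 Δ Y)
      ≤ 5 / 2 * √((∑ m, (K m : ℝ)) * sigma (mode23 Q Q) 1) * r := by
  have : Nonempty (Fin M) := ⟨⟨0, by omega⟩⟩
  have hr : 0 ≤ r := (norm_nonneg _).trans (hYn (Classical.arbitrary _))
  have hYr' : ∀ m, ((slice Y m).rank : ℝ) ≤ 3 * K m := fun m => by exact_mod_cast hYr m
  have hK : 0 ≤ ∑ m, (K m : ℝ) := Finset.sum_nonneg fun _ _ => Nat.cast_nonneg _
  have hσ1 := sigma_nonneg (mode23 Q Q) 1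
  have hτ := tensorNorm_nonneg Δ
  set k := ∑ m, (K m : ℝ)
  set σ₁ := sigma (mode23 Q Q) 1
  have h1 : ‖Y‖ ^ 2 ≤ 3 * k * r ^ 2 := by
    rw [norm_sq_eq_sum_frob, Finset.mul_sum, Finset.sum_mul]
    refine Finset.sum_le_sum fun m _ => (frob_sq_le_rank _).trans ?_
    exact mul_le_mul (hYr' m) (pow_le_pow_left₀ (norm_nonneg _) (hYn m) 2) (by positivity)
      (by positivity)
  have h2 : frob (mode23 Q Y) ≤ 7 / 4 * √(k * σ₁) * r := by
    refine le_of_sq_le_sq ?_ (by positivity)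
    have h3 := pow_le_pow_left₀ (frob_nonneg _) (frob_mode23_le Q Y) 2
    rw [mul_pow, Real.sq_sqrt hσ1] at h3
    have h4 : σ₁ * ‖Y‖ ^ 2 ≤ σ₁ * (3 * k * r ^ 2) := mul_le_mul_of_nonneg_left h1 hσ1
    rw [mul_pow, mul_pow, Real.sq_sqrt (by positivity)]
    have h5 : 0 ≤ σ₁ * (k * r ^ 2) := by positivity
    linarith
  have h3 : frob (mode23 Δ Y) ≤ 3 / 4 * √(k * σ₁) * r := by
    refine le_of_sq_le_sq ?_ (by positivity)
    rw [mul_pow, mul_pow, Real.sq_sqrt (by positivity), frob_sq_eq_sum_colv]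
    have h4 : (3 / 4) ^ 2 * (k * σ₁) * r ^ 2 = ∑ m, (3 / 4) ^ 2 * (K m * σ₁) * r ^ 2 := by
      simp only [k, Finset.sum_mul, Finset.mul_sum]
    rw [h4]
    refine Finset.sum_le_sum fun m _ => ?_
    have h5 : ‖colv (mode23 Δ Y) m‖ ≤ 3 * K m * (tensorNorm Δ * r) :=
      (norm_colv_mode23_le Δ Y m).trans (mul_le_mul (hYr' m)
        (mul_le_mul_of_nonneg_left (hYn m) hτ) (by positivity) (by positivity))
    -- one factor `K m` is absorbed by `K_m σ_min² ≤ σ₁(G)`, since `‖Δ‖ ≤ σ_min / 4`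
    have h6 : tensorNorm Δ ^ 2 ≤ (1 / 4 * sigmaMin K Q) ^ 2 := pow_le_pow_left₀ hτ hΔ 2
    have h7 := card_mul_sigmaMin_sq_le hM hsymm hrank hκ m
    calc ‖colv (mode23 Δ Y) m‖ ^ 2 ≤ (3 * K m * (tensorNorm Δ * r)) ^ 2 :=
          pow_le_pow_left₀ (norm_nonneg _) h5 2
      _ = 9 * (K m * (K m * tensorNorm Δ ^ 2)) * r ^ 2 := by ring
      _ ≤ 9 * (K m * (K m * (1 / 4 * sigmaMin K Q) ^ 2)) * r ^ 2 := by gcongr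
      _ = (3 / 4) ^ 2 * (K m * (K m * sigmaMin K Q ^ 2)) * r ^ 2 := by ring
      _ ≤ _ := by gcongr
  linarith

variable {V W : Matrix (Fin L) (Fin M) ℝ}

lemma mode1_observed (hV : Vᵀ * V = 1) :
    mode1 (trueTensor Q V + Δ) W = Q + (mode1 Q (Vᵀ * (W - V)) + mode1 Δ W) := by
  rw [add_mode1, mode1_trueTensor, Matrix.mul_sub, hV, mode1_sub, mode1_one]
  abel

/-- The rank projection of `A ×₁ W` is, up to second-order terms, the tangential projection. -/
lemma rankProj_remainder (hM : 2 ≤ M) (hsymm : ∀ m, (slice Q m).IsSymm)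
    (hrank : ∀ m, (slice Q m).rank = K m) (hκ : 0 < sigma (mode23 Q Q) M)
    (hΔsymm : ∀ l, (slice Δ l).IsSymm)
    (hV : Vᵀ * V = 1) (hW : Wᵀ * W = 1) {e : ℝ} (he : frob (W - V) ≤ e) {Y : Tensor M n}
    (hY : IsRankProj K (mode1 (trueTensor Q V + Δ) W) Y) (m : Fin M) :
    (slice (Y - (L1 Q).starProjection (mode1 (trueTensor Q V + Δ) W)) m).rank ≤ 3 * K m ∧
    ‖slice (Y - (L1 Q).starProjection (mode1 (trueTensor Q V + Δ) W)) m‖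
      ≤ 12 * (tensorNorm Q * e + tensorNorm Δ) ^ 2 / sigmaMin K Q := by
  have hX : slice (mode1 (trueTensor Q V + Δ) W) m
      = slice Q m + (comb Q (colv (Vᵀ * (W - V)) m) + comb Δ (colv W m)) := by
    rw [mode1_observed hV]; rfl
  rw [slice_sub, slice_starProjection_L1, hX]
  have hbest : IsBestApprox (K m)
      (slice Q m + (comb Q (colv (Vᵀ * (W - V)) m) + comb Δ (colv W m))) (slice Y m) := by
    rw [← hX]; exact hY m
  have hcomb : ∀ {d : ℕ} (X : Tensor d n) (u : EuclideanSpace ℝ (Fin d)),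
      (∀ l, (slice X l).IsSymm) → (comb X u)ᵀ = comb X u := fun X u h => by
    simp only [comb, Matrix.transpose_sum, transpose_smul]
    exact Finset.sum_congr rfl fun l _ => by rw [h l]
  have hZt : (comb Q (colv (Vᵀ * (W - V)) m) + comb Δ (colv W m))ᵀ
      = comb Q (colv (Vᵀ * (W - V)) m) + comb Δ (colv W m) := by
    rw [transpose_add, hcomb Q _ hsymm, hcomb Δ _ hΔsymm]
  have hZ : ‖comb Q (colv (Vᵀ * (W - V)) m) + comb Δ (colv W m)‖
      ≤ tensorNorm Q * e + tensorNorm Δ := by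
    have h1 : ‖colv W m‖ = 1 := by
      rw [colv_eq_mv, norm_mv_of_isometry hW]; simp
    have h2 : ‖colv (Vᵀ * (W - V)) m‖ ≤ e :=
      (norm_colv_le _ m).trans ((frob_transpose_mul_le_of_isometry hV _).trans he)
    have h3 := opNorm_comb_le Δ (colv W m)
    rw [h1, mul_one] at h3
    exact (norm_add_le _ _).trans (add_le_add ((opNorm_comb_le Q _).trans
      (mul_le_mul_of_nonneg_left h2 (tensorNorm_nonneg Q))) h3)
  exact ⟨hbest.rank_sub_tangent_le (hrank m),
    hbest.opNorm_sub_tangent_le (hsymm m) hZt (hrank m) (sigmaMin_pos hM hrank hκ)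
      (sigmaMin_mul_norm_le hsymm hrank m) hZ⟩

end remainder

/-! ### One step of the iteration -/

section step
variable {n L M : ℕ} {K : Fin M → ℕ} {Q : Tensor M n} {Δ : Tensor L n}
  {V W : Matrix (Fin L) (Fin M) ℝ}

/-- The noise level `max_m ‖Π_T(Δ) ×₂₃ Π_T(Δ)‖ + 2 max_m ‖Π_T(Q) ×₂₃ Π_T(Δ)‖`. -/
def noiseLevel (Q : Tensor M n) (Δ : Tensor L n) : ℝ :=
  (⨆ m, opNorm (mode23 (tangentProj Q m Δ) (tangentProj Q m Δ)))
    + 2 * ⨆ m, opNorm (mode23 (tangentProj Q m Q) (tangentProj Q m Δ))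

lemma noiseLevel_nonneg (Q : Tensor M n) (Δ : Tensor L n) : 0 ≤ noiseLevel Q Δ := by
  have h1 := Real.iSup_nonneg fun m =>
    norm_nonneg (mode23 (tangentProj Q m Δ) (tangentProj Q m Δ))
  have h2 := Real.iSup_nonneg fun m =>
    norm_nonneg (mode23 (tangentProj Q m Q) (tangentProj Q m Δ))
  exact add_nonneg h1 (mul_nonneg zero_le_two h2)

/-- The terms of first order in the noise. -/
lemma frob_noise_le (hV : Vᵀ * V = 1) (hW : Wᵀ * W = 1) :
    frob (mode23 Q ((L1 Q).starProjection (mode1 Δ W)))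
      + frob (mode23 Δ ((L1 Q).starProjection (mode1 Q (Vᵀ * W))))
      + frob (mode23 Δ ((L1 Q).starProjection (mode1 Δ W))) ≤ √M * noiseLevel Q Δ := by
  set D₁ := ⨆ m, opNorm (mode23 (tangentProj Q m Q) (tangentProj Q m Δ)) with hD₁
  set D₂ := ⨆ m, opNorm (mode23 (tangentProj Q m Δ) (tangentProj Q m Δ)) with hD₂
  have h1 : ∀ m, ‖mode23 (tangentProj Q m Q) (tangentProj Q m Δ)‖ ≤ D₁ := fun m =>
    le_ciSup (f := fun m => opNorm (mode23 (tangentProj Q m Q) (tangentProj Q m Δ)))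
      (Set.finite_range _).bddAbove m
  have h2 : ∀ m, ‖mode23 (tangentProj Q m Δ) (tangentProj Q m Δ)‖ ≤ D₂ := fun m =>
    le_ciSup (f := fun m => opNorm (mode23 (tangentProj Q m Δ) (tangentProj Q m Δ)))
      (Set.finite_range _).bddAbove m
  have h3 : 0 ≤ D₁ := Real.iSup_nonneg fun m => norm_nonneg _
  have h4 : 0 ≤ D₂ := Real.iSup_nonneg fun m => norm_nonneg _
  have hcol : ∀ m, ‖colv W m‖ = 1 := fun m => by
    rw [colv_eq_mv, norm_mv_of_isometry hW]; simp
  have hcol' : ∀ m, ‖colv (Vᵀ * W) m‖ ≤ 1 := fun m => by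
    rw [colv_mul]
    refine (norm_mv_le _ _).trans ?_
    rw [norm_transpose, hcol, mul_one]
    exact opNorm_le_one_of_isometry hV
  have key : ∀ {x D w : ℝ}, 0 ≤ D → x ≤ D → w ≤ 1 → 0 ≤ w → x * w ≤ D := fun hD hx hw hw0 =>
    (mul_le_mul hx hw hw0 hD).trans_eq (mul_one _)
  have b1 := frob_le_sqrt_mul (mode23 Q ((L1 Q).starProjection (mode1 Δ W))) h3 fun m => by
    rw [colv_mode23_starProjection_L1]
    exact (norm_mv_le _ _).trans (key h3 (h1 m) (hcol m).le (norm_nonneg _))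
  have b2 := frob_le_sqrt_mul (mode23 Δ ((L1 Q).starProjection (mode1 Q (Vᵀ * W)))) h3
    fun m => by
      rw [colv_mode23_starProjection_L1]
      refine (norm_mv_le _ _).trans (key h3 ?_ (hcol' m) (norm_nonneg _))
      rw [← mode23_transpose, norm_transpose]
      exact h1 m
  have b3 := frob_le_sqrt_mul (mode23 Δ ((L1 Q).starProjection (mode1 Δ W))) h4 fun m => by
    rw [colv_mode23_starProjection_L1]
    exact (norm_mv_le _ _).trans (key h4 (h2 m) (hcol m).le (norm_nonneg _))
  have : √M * noiseLevel Q Δ = √M * D₁ + √M * D₁ + √M * D₂ := by rw [noiseLevel]; ring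
  linarith

/-- Expansion of `A ×₂₃ Q⁺`: the leading part `W_* G`, the part linear in the skew-symmetric
component of `W_*ᵀ (W - W_*)`, and a remainder. -/
lemma exists_expansion (hM : 2 ≤ M) (hsymm : ∀ m, (slice Q m).IsSymm)
    (hrank : ∀ m, (slice Q m).rank = K m) (hκ : 0 < sigma (mode23 Q Q) M)
    (hΔsymm : ∀ l, (slice Δ l).IsSymm) (hΔ : tensorNorm Δ ≤ 1 / 4 * sigmaMin K Q)
    (hV : Vᵀ * V = 1) (hW : Wᵀ * W = 1) {e : ℝ} (he : frob (W - V) ≤ e) {Y : Tensor M n}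
    (hY : IsRankProj K (mode1 (trueTensor Q V + Δ) W) Y) :
    ∃ N : Matrix (Fin L) (Fin M) ℝ,
      mode23 (trueTensor Q V + Δ) Y = V * mode23 Q Q
        + V * mode23 Q ((L1 Q).starProjection (mode1 Q (skewPart (Vᵀ * (W - V))))) + N ∧
      frob N ≤ sigma (mode23 Q Q) 1 * e ^ 2 / 2 + √M * noiseLevel Q Δ
        + 30 * √((∑ m, (K m : ℝ)) * sigma (mode23 Q Q) 1)
          * (tensorNorm Q * e + tensorNorm Δ) ^ 2 / sigmaMin K Q := by
  set T := (L1 Q).starProjection with hT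
  set S : Matrix (Fin M) (Fin M) ℝ := (-(1 / 2) : ℝ) • ((W - V)ᵀ * (W - V)) with hS
  set Z := skewPart (Vᵀ * (W - V)) with hZ
  set R := Y - T (mode1 (trueTensor Q V + Δ) W) with hR
  have hVW : Vᵀ * W = 1 + Z + S := by
    have h1 := transpose_mul_sub_skewPart hV hW
    rw [← hZ, ← hS] at h1
    rw [add_assoc, ← h1, Matrix.mul_sub, hV]
    abel
  -- The expansion `hY1` is contracted with `P_*`.  For the contraction with `Δ`, `Vᵀ W` is kept
  -- whole (`hY2`): its columns have norm at most one, so no noise term depends on `e`.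
  have hY1 : Y = Q + T (mode1 Q Z) + T (mode1 Q S) + T (mode1 Δ W) + R := by
    have h1 : T (mode1 (trueTensor Q V + Δ) W)
        = Q + T (mode1 Q Z) + T (mode1 Q S) + T (mode1 Δ W) := by
      rw [add_mode1, mode1_trueTensor, hVW, mode1_add, mode1_add, mode1_one, map_add, map_add,
        map_add, hT, starProjection_L1_self]
    rw [hR, h1]; abel
  have hY2 : Y = T (mode1 Q (Vᵀ * W)) + T (mode1 Δ W) + R := by
    rw [hR, add_mode1, mode1_trueTensor, map_add]; abel
  refine ⟨V * mode23 Q (T (mode1 Q S)) + V * mode23 Q (T (mode1 Δ W)) + V * mode23 Q R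
    + mode23 Δ (T (mode1 Q (Vᵀ * W))) + mode23 Δ (T (mode1 Δ W)) + mode23 Δ R, ?_, ?_⟩
  · rw [add_mode23, mode23_trueTensor]
    nth_rw 1 [hY1]
    rw [hY2]
    simp only [mode23_add, Matrix.mul_add]
    abel
  · have hrem := rankProj_remainder hM hsymm hrank hκ hΔsymm hV hW he hY
    have b1 := frob_mode23_remainder_le hM hsymm hrank hκ hΔ (fun m => (hrem m).1)
      (fun m => (hrem m).2)
    have b2 := frob_noise_le (Q := Q) (Δ := Δ) hV hW
    rw [← hT] at b1 b2
    rw [← hR] at b1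
    have b3 : frob (mode23 Q (T (mode1 Q S))) ≤ sigma (mode23 Q Q) 1 * e ^ 2 / 2 := by
      have hσ1 := sigma_nonneg (mode23 Q Q) 1
      have h1 : frob S ≤ e ^ 2 / 2 := frob_symmPart_le.trans (by
        have := pow_le_pow_left₀ (frob_nonneg _) he 2
        linarith)
      have h2 : ‖T (mode1 Q S)‖ ≤ √(sigma (mode23 Q Q) 1) * (e ^ 2 / 2) :=
        (Submodule.norm_starProjection_apply_le _ _).trans ((norm_mode1_le Q S).trans
          (mul_le_mul_of_nonneg_left h1 (Real.sqrt_nonneg _)))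
      calc frob (mode23 Q (T (mode1 Q S)))
          ≤ √(sigma (mode23 Q Q) 1) * (√(sigma (mode23 Q Q) 1) * (e ^ 2 / 2)) :=
            (frob_mode23_le Q _).trans (mul_le_mul_of_nonneg_left h2 (Real.sqrt_nonneg _))
        _ = _ := by rw [← mul_assoc, Real.mul_self_sqrt hσ1]; ring
    have c1 := frob_add_le (V * mode23 Q (T (mode1 Q S)) + V * mode23 Q (T (mode1 Δ W))
      + V * mode23 Q R + mode23 Δ (T (mode1 Q (Vᵀ * W))) + mode23 Δ (T (mode1 Δ W))) (mode23 Δ R)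
    have c2 := frob_add_le (V * mode23 Q (T (mode1 Q S)) + V * mode23 Q (T (mode1 Δ W))
      + V * mode23 Q R + mode23 Δ (T (mode1 Q (Vᵀ * W)))) (mode23 Δ (T (mode1 Δ W)))
    have c3 := frob_add_le (V * mode23 Q (T (mode1 Q S)) + V * mode23 Q (T (mode1 Δ W))
      + V * mode23 Q R) (mode23 Δ (T (mode1 Q (Vᵀ * W))))
    have c4 := frob_add_le (V * mode23 Q (T (mode1 Q S)) + V * mode23 Q (T (mode1 Δ W)))
      (V * mode23 Q R)
    have c5 := frob_add_le (V * mode23 Q (T (mode1 Q S))) (V * mode23 Q (T (mode1 Δ W)))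
    rw [frob_mul_of_isometry hV] at c4 c5
    rw [frob_mul_of_isometry hV] at c5
    have b4 : 5 / 2 * √((∑ m, (K m : ℝ)) * sigma (mode23 Q Q) 1)
        * (12 * (tensorNorm Q * e + tensorNorm Δ) ^ 2 / sigmaMin K Q)
        = 30 * √((∑ m, (K m : ℝ)) * sigma (mode23 Q Q) 1)
          * (tensorNorm Q * e + tensorNorm Δ) ^ 2 / sigmaMin K Q := by ring
    rw [b4] at b1
    linarith

/-- The remainder, relative to `σ_M(G)`, is bounded by `(a₁ + a₂ e²) / 3`. -/
lemma remainder_le_constants (hM : 2 ≤ M)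
    (hrank : ∀ m, (slice Q m).rank = K m) (hκ : 0 < sigma (mode23 Q Q) M) {e : ℝ} :
    sigma (mode23 Q Q) 1 * e ^ 2 / 2 + √M * noiseLevel Q Δ
        + 30 * √((∑ m, (K m : ℝ)) * sigma (mode23 Q Q) 1)
          * (tensorNorm Q * e + tensorNorm Δ) ^ 2 / sigmaMin K Q
      ≤ sigma (mode23 Q Q) M * ((a1 K Q Δ + a2 K Q Δ * e ^ 2) / 3) := by
  have hσ := sigmaMin_pos hM hrank hκ
  have hκ0 := one_le_kappa0 hM hκ
  have hnoise := noiseLevel_nonneg Q Δ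
  have hsM := card_mul_sigma_le hrank
  have hσ1 : sigma (mode23 Q Q) 1 = kappa0 Q * sigma (mode23 Q Q) M := by
    rw [kappa0, div_mul_cancel₀ _ hκ.ne']
  have ht := tensorNorm_nonneg Q
  have hτ := tensorNorm_nonneg Δ
  have hK : 0 ≤ ∑ m, (K m : ℝ) := Finset.sum_nonneg fun _ _ => Nat.cast_nonneg _
  have hMpos : (0 : ℝ) < M := by exact_mod_cast (by omega : 0 < M)
  have ha1 : a1 K Q Δ = 6 * kappa0 Q * (√M * noiseLevel Q Δ / sigma (mode23 Q Q) M)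
    + 192 * kappa0 Q * (∑ m, (K m : ℝ)) * tensorNorm Δ ^ 2 * (tensorNorm Q + tensorNorm Δ)
        / (√M * sigmaMin K Q * sigma (mode23 Q Q) M) := rfl
  rw [ha1, a2, hσ1]
  set s := sigma (mode23 Q Q) M
  set k := ∑ m, (K m : ℝ)
  set t := tensorNorm Q
  set τ := tensorNorm Δ
  set σ := sigmaMin K Q
  set κ := kappa0 Q
  set q := √(M : ℝ)
  set ν := noiseLevel Q Δ
  have hq : 0 < q := Real.sqrt_pos.2 hMpos
  have hqq : q ^ 2 = M := Real.sq_sqrt hMpos.le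
  -- `√(K̇ σ₁) ≤ κ₀ K̇ ‖Q‖ / √M`
  have h1 : √(k * (κ * s)) ≤ κ * k * t / q := by
    rw [le_div_iff₀ hq]
    refine le_of_sq_le_sq ?_ (by positivity)
    rw [mul_pow, Real.sq_sqrt (by positivity), hqq]
    calc k * (κ * s) * M = κ * k * (M * s) := by ring
      _ ≤ κ * k * (k * t ^ 2) := by gcongr
      _ = κ * (k * t) ^ 2 := by ring
      _ ≤ κ ^ 2 * (k * t) ^ 2 := by gcongr; nlinarith
      _ = (κ * k * t) ^ 2 := by ring
  have h2 : (t * e + τ) ^ 2 ≤ 2 * (t ^ 2 * e ^ 2 + τ ^ 2) := by nlinarith [sq_nonneg (t * e - τ)]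
  have h3 : 30 * √(k * (κ * s)) * (t * e + τ) ^ 2 / σ
      ≤ 64 * κ * k * (t + τ) / (q * σ) * (t ^ 2 * e ^ 2 + τ ^ 2) := by
    calc 30 * √(k * (κ * s)) * (t * e + τ) ^ 2 / σ
        ≤ 30 * (κ * k * t / q) * (2 * (t ^ 2 * e ^ 2 + τ ^ 2)) / σ := by gcongr
      _ = 60 * κ * k * t / (q * σ) * (t ^ 2 * e ^ 2 + τ ^ 2) := by field_simp; ring
      _ ≤ _ := by
        gcongr
        · norm_num
        · linarith
  have h4 : s * ((6 * κ * (q * ν / s) + 192 * κ * k * τ ^ 2 * (t + τ) / (q * σ * s)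
      + (192 * κ * k * t ^ 2 * (t + τ) / (q * σ * s) + 6 * κ) * e ^ 2) / 3)
      = 2 * κ * (q * ν) + 64 * κ * k * (t + τ) / (q * σ) * (t ^ 2 * e ^ 2 + τ ^ 2)
        + 2 * (κ * s * e ^ 2) := by
    field_simp
    ring
  rw [h4]
  have h5 : q * ν ≤ 2 * κ * (q * ν) := by
    have : 0 ≤ q * ν := by positivity
    nlinarith
  have h6 : 0 ≤ κ * s * e ^ 2 := by positivity
  linarith

/-- The scalar inequality behind the contraction estimate: below the radius, the quadratic terms
cost at most half of the gap `1 - κ_H`. -/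
lemma quadratic_terms_le {κ ν δ e R a₁ a₂ C q : ℝ} (hκ : 1 ≤ κ) (hν : 0 ≤ ν) (he : 0 ≤ e)
    (heR : e ≤ R) (hC : 1 ≤ C) (hq0 : 0 ≤ q) (ha₂ : 0 ≤ a₂)
    (hR : R * (C * (a₂ + 80 * κ ^ 2 + 32 * κ ^ 3)) ≤ (1 - q) / 2)
    (ha₁ : C * a₁ ≤ (1 - q) / 2 * R)
    (hνa : ν = (a₁ + a₂ * e ^ 2) / 3) (hδ : δ = κ * e + ν) :
    δ ≤ 1 / 20 ∧ q * e + C * ((2 * κ * δ ^ 2 + ν + 2 * δ ^ 2) + (2 * δ ^ 2 + 20 / 19 * ν))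
      ≤ (1 + q) / 2 * e + C * a₁ := by
  have hR0 : 0 ≤ R := he.trans heR
  set c := a₂ + 80 * κ ^ 2 + 32 * κ ^ 3 with hc
  have hc0 : 0 ≤ c := by positivity
  have h1 : R * c ≤ 1 / 2 := by
    have h2 : R * c ≤ R * (C * c) := by
      have : c ≤ C * c := le_mul_of_one_le_left hc0 hC
      exact mul_le_mul_of_nonneg_left this hR0
    linarith
  have h2 : R * (80 * κ ^ 2) ≤ 1 / 2 := by
    have : 80 * κ ^ 2 ≤ c := by have : 0 ≤ κ ^ 3 := by positivity
                                linarith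
    exact (mul_le_mul_of_nonneg_left this hR0).trans h1
  have h3 : κ * R ≤ 1 / 160 := by nlinarith [mul_nonneg hR0 (by linarith : (0 : ℝ) ≤ κ)]
  have h4 : a₁ ≤ R / 2 := by
    by_contra! h
    have h5 : R / 2 * 1 ≤ a₁ * C := mul_le_mul h.le hC zero_le_one (by linarith)
    have h6 : (1 - q) / 2 * R ≤ R / 2 := by nlinarith
    have h7 : a₁ * 1 ≤ a₁ * C := mul_le_mul_of_nonneg_left hC (by linarith)
    linarith
  have h5 : a₂ * e ^ 2 ≤ R / 2 := by
    have h6 : a₂ * R ≤ 1 / 2 := by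
      have : a₂ ≤ c := by have : 0 ≤ κ ^ 3 := by positivity
                          have : 0 ≤ κ ^ 2 := by positivity
                          linarith
      have := mul_le_mul_of_nonneg_left this hR0
      linarith
    have h7 : a₂ * e ≤ 1 / 2 := (mul_le_mul_of_nonneg_left heR ha₂).trans h6
    nlinarith
  have h6 : ν ≤ R / 3 := by linarith
  have hRκ : R ≤ κ * R := le_mul_of_one_le_left hR0 hκ
  have h7 : κ * e ≤ κ * R := mul_le_mul_of_nonneg_left heR (by linarith)
  refine ⟨by linarith, ?_⟩
  have h8 : δ ^ 2 ≤ 2 * (κ ^ 2 * e ^ 2) + 2 * ν ^ 2 := by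
    rw [hδ]; nlinarith [sq_nonneg (κ * e - ν)]
  have h9 : κ * ν ^ 2 ≤ 1 / 480 * ν := by
    have : κ * ν ≤ κ * (R / 3) := mul_le_mul_of_nonneg_left h6 (by linarith)
    nlinarith
  have h10 : ν ^ 2 ≤ κ * ν ^ 2 := le_mul_of_one_le_left (sq_nonneg _) hκ
  have h11 : (2 * κ + 4) * δ ^ 2 ≤ (2 * κ + 4) * (2 * (κ ^ 2 * e ^ 2) + 2 * ν ^ 2) :=
    mul_le_mul_of_nonneg_left h8 (by linarith)
  have h12 : (2 * κ * δ ^ 2 + ν + 2 * δ ^ 2) + (2 * δ ^ 2 + 20 / 19 * ν) ≤ a₁ + c * e ^ 2 := by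
    have h13 : 0 ≤ κ ^ 3 * e ^ 2 := by positivity
    have h14 : 0 ≤ κ ^ 2 * e ^ 2 := by positivity
    have h15 : c * e ^ 2 = a₂ * e ^ 2 + 80 * (κ ^ 2 * e ^ 2) + 32 * (κ ^ 3 * e ^ 2) := by
      rw [hc]; ring
    have h16 : (2 * κ + 4) * (2 * (κ ^ 2 * e ^ 2) + 2 * ν ^ 2)
        = 4 * (κ ^ 3 * e ^ 2) + 8 * (κ ^ 2 * e ^ 2) + 4 * (κ * ν ^ 2) + 8 * ν ^ 2 := by ring
    linarith
  have h13 := mul_le_mul_of_nonneg_left h12 (by linarith : (0 : ℝ) ≤ C)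
  have h14 : C * (c * e ^ 2) ≤ (1 - q) / 2 * e := by
    have h15 : e * (C * c) ≤ (1 - q) / 2 :=
      (mul_le_mul_of_nonneg_right heR (by positivity)).trans hR
    nlinarith
  linarith

lemma a1_nonneg (hM : 2 ≤ M) (hrank : ∀ m, (slice Q m).rank = K m)
    (hκ : 0 < sigma (mode23 Q Q) M) : 0 ≤ a1 K Q Δ := by
  have := sigmaMin_pos hM hrank hκ
  have := one_le_kappa0 hM hκ
  have := noiseLevel_nonneg Q Δ
  have := tensorNorm_nonneg Q
  have := tensorNorm_nonneg Δ
  have : 0 ≤ ∑ m, (K m : ℝ) := Finset.sum_nonneg fun _ _ => Nat.cast_nonneg _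
  change 0 ≤ 6 * kappa0 Q * (√M * noiseLevel Q Δ / sigma (mode23 Q Q) M) + _
  positivity

lemma a2_nonneg (hM : 2 ≤ M) (hrank : ∀ m, (slice Q m).rank = K m)
    (hκ : 0 < sigma (mode23 Q Q) M) : 0 ≤ a2 K Q Δ := by
  have := sigmaMin_pos hM hrank hκ
  have := one_le_kappa0 hM hκ
  have := tensorNorm_nonneg Q
  have := tensorNorm_nonneg Δ
  have : 0 ≤ ∑ m, (K m : ℝ) := Finset.sum_nonneg fun _ _ => Nat.cast_nonneg _
  rw [a2]
  positivity

/-- One step of the iteration, started within the radius. -/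
lemma step_contraction (hM : 2 ≤ M) (hsymm : ∀ m, (slice Q m).IsSymm)
    (hrank : ∀ m, (slice Q m).rank = K m) (hκ : 0 < sigma (mode23 Q Q) M)
    (hA1 : L1 Q ⊓ L2 Q = ⊥)
    (hΔsymm : ∀ l, (slice Δ l).IsSymm) (hΔ : tensorNorm Δ ≤ 1 / 4 * sigmaMin K Q)
    (ha : 2 * CH Q * a1 K Q Δ / (1 - kappaH Q) ≤ radius K Q Δ)
    (hV : Vᵀ * V = 1) (hW : Wᵀ * W = 1) (hR : dNorm Q V (W - V) ≤ radius K Q Δ) {Y : Tensor M n}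
    (hY : IsRankProj K (mode1 (trueTensor Q V + Δ) W) Y) :
    (polar (mode23 (trueTensor Q V + Δ) Y))ᵀ * polar (mode23 (trueTensor Q V + Δ) Y) = 1 ∧
    dNorm Q V (polar (mode23 (trueTensor Q V + Δ) Y) - V)
      ≤ (1 + kappaH Q) / 2 * dNorm Q V (W - V) + CH Q * a1 K Q Δ := by
  have hq0 := kappaH_nonneg Q
  have hq1 := kappaH_lt_one Q hA1
  have hC := one_le_CH Q hM hκ
  have hκ0 := one_le_kappa0 hM hκ
  have ha1 := a1_nonneg (Δ := Δ) hM hrank hκ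
  have ha2 := a2_nonneg (Δ := Δ) hM hrank hκ
  have he0 := dNorm_nonneg Q V (W - V)
  set e := dNorm Q V (W - V) with he
  set s := sigma (mode23 Q Q) M with hs
  have hσ1 : sigma (mode23 Q Q) 1 = kappa0 Q * s := by
    rw [kappa0, div_mul_cancel₀ _ hκ.ne']
  have hfrob : frob (W - V) ≤ e := frob_le_dNorm Q hV hM hκ _
  obtain ⟨N, hexp, hN⟩ := exists_expansion hM hsymm hrank hκ hΔsymm hΔ hV hW hfrob hY
  have hN' := hN.trans (remainder_le_constants hM hrank hκ)
  set Z := skewPart (Vᵀ * (W - V)) with hZ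
  set B := mode23 Q ((L1 Q).starProjection (mode1 Q Z)) with hB
  obtain ⟨Yp, hYp, hYpB, hLyap⟩ := exists_skew_starProjection_L2 Q
    ((L1 Q).starProjection (mode1 Q Z))
  rw [← hB] at hLyap
  set ν := (a1 K Q Δ + a2 K Q Δ * e ^ 2) / 3 with hν
  set δ := kappa0 Q * e + ν with hδ
  have hν0 : 0 ≤ ν := by positivity
  have hRpos : radius K Q Δ * (CH Q * (a2 K Q Δ + 80 * kappa0 Q ^ 2 + 32 * kappa0 Q ^ 3))
      ≤ (1 - kappaH Q) / 2 := by
    have h1 : radius K Q Δ ≤ _ := min_le_left _ _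
    rw [le_div_iff₀ (by positivity)] at h1
    linarith
  have haR : CH Q * a1 K Q Δ ≤ (1 - kappaH Q) / 2 * radius K Q Δ := by
    rw [div_le_iff₀ (by linarith)] at ha
    linarith
  obtain ⟨hδ20, hfinal⟩ := quadratic_terms_le hκ0 hν0 he0 hR hC hq0 ha2 hRpos haR hν hδ
  -- the linear part `B` has size at most `σ₁ e`
  have hBn : frob (V * B) ≤ s * (kappa0 Q * e) := by
    have h1 : frob Z ≤ e := by
      have h2 := sInf_skewValues_mul_frob_le Q (skewPart_transpose (Vᵀ * (W - V)))
      have h3 := le_dNorm Q hV (W - V)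
      have hpos := sInf_skewValues_pos Q hM hκ
      rw [inv_mul_eq_div, div_le_iff₀ hpos] at h3
      refine le_of_mul_le_mul_left ?_ hpos
      rw [← hZ] at h2 h3
      linarith
    have h4 : ‖(L1 Q).starProjection (mode1 Q Z)‖ ≤ √(sigma (mode23 Q Q) 1) * e :=
      (Submodule.norm_starProjection_apply_le _ _).trans ((norm_mode1_le Q Z).trans
        (mul_le_mul_of_nonneg_left h1 (Real.sqrt_nonneg _)))
    rw [frob_mul_of_isometry hV]
    calc frob B ≤ √(sigma (mode23 Q Q) 1) * (√(sigma (mode23 Q Q) 1) * e) :=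
          (frob_mode23_le Q _).trans (mul_le_mul_of_nonneg_left h4 (Real.sqrt_nonneg _))
      _ = s * (kappa0 Q * e) := by
          rw [← mul_assoc, Real.mul_self_sqrt (sigma_nonneg _ _), hσ1]; ring
  have hD : frob (V * B + N) ≤ s * δ := by
    have := frob_add_le (V * B) N
    rw [hδ, mul_add]
    linarith
  have hpol := polar_expansion hV (gram_transpose Q) hκ (le_inner_gram Q) (opNorm_gram_le Q) hYp
    hLyap hD hN' hδ20
  rw [← hexp] at hpol
  obtain ⟨hW', hU, hE⟩ := hpol
  refine ⟨hW', ?_⟩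
  set W' := polar (mode23 (trueTensor Q V + Δ) Y)
  set Y' := skewPart (Vᵀ * (W' - V)) with hY'
  have hratio : sigma (mode23 Q Q) 1 / sigma (mode23 Q Q) M = kappa0 Q := rfl
  rw [hratio] at hU
  have hpos := sInf_skewValues_pos Q hM hκ
  -- the linear part contracts by `κ_H`
  have h1 : (sInf (skewValues Q))⁻¹ * ‖mode1 Q Yp‖ ≤ kappaH Q * e := by
    rw [← hYpB]
    have h2 := norm_proj_proj_le_kappaH Q (mode1 Q Z)
    have h3 := le_dNorm Q hV (W - V)
    rw [← hZ, ← he] at h3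
    calc _ ≤ (sInf (skewValues Q))⁻¹ * (kappaH Q * ‖mode1 Q Z‖) := by gcongr
      _ = kappaH Q * ((sInf (skewValues Q))⁻¹ * ‖mode1 Q Z‖) := by ring
      _ ≤ _ := by gcongr
  have h2 : (sInf (skewValues Q))⁻¹ * ‖mode1 Q (Y' - Yp)‖ ≤ CH Q * frob (Y' - Yp) := by
    have h3 := norm_mode1_le_sSup_skewValues Q (Y := Y' - Yp) (by
      rw [transpose_sub, hY', skewPart_transpose, hYp]; abel)
    rw [CH, div_eq_inv_mul, mul_assoc]
    gcongr
  have h3 : ‖mode1 Q Y'‖ ≤ ‖mode1 Q Yp‖ + ‖mode1 Q (Y' - Yp)‖ := by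
    have : mode1 Q Y' = mode1 Q Yp + mode1 Q (Y' - Yp) := by
      rw [← mode1_add]; congr 1; abel
    rw [this]; exact norm_add_le _ _
  have h4 := mul_le_mul_of_nonneg_left h3 (inv_nonneg.2 hpos.le)
  rw [mul_add] at h4
  have h5 := dNorm_le_add Q hV hM hκ (W' - V)
  rw [← hY'] at h5
  have h6 : frob (W' - V - V * Y') ≤ CH Q * (2 * δ ^ 2 + 20 / 19 * ν) :=
    hE.trans (le_mul_of_one_le_left (by positivity) hC)
  have h7 := mul_le_mul_of_nonneg_left hU (by linarith : 0 ≤ CH Q)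
  rw [mul_add] at hfinal
  linarith

end step

/-! ### Recursive inequalities -/

/-- A sequence with `d (t + 1) ≤ q d t + b` for `t ≥ 1`, `q < 1`, is bounded above, with limit
superior at most `b / (1 - q)`. -/
lemma limsup_le_of_contraction {d : ℕ → ℝ} {q b β : ℝ} (hq0 : 0 ≤ q) (hq1 : q < 1)
    (hd0 : ∀ t, 0 ≤ d t) (hβ : q * β + b = β) (h : ∀ t, 1 ≤ t → d (t + 1) ≤ q * d t + b) :
    IsBoundedUnder (· ≤ ·) atTop d ∧ limsup d atTop ≤ β := by
  have h1 : ∀ t, d (t + 1) ≤ β + q ^ t * (d 1 - β) := by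
    intro t
    induction t with
    | zero => simp
    | succ t ih =>
      refine (h (t + 1) (by omega)).trans ?_
      have h2 := mul_le_mul_of_nonneg_left ih hq0
      have h3 : q ^ (t + 1) * (d 1 - β) = q * (q ^ t * (d 1 - β)) := by rw [pow_succ]; ring
      rw [h3]
      linarith
  have hlim : Tendsto (fun t : ℕ => β + q ^ t * (d 1 - β)) atTop (nhds β) := by
    have := ((tendsto_pow_atTop_nhds_zero_of_lt_one hq0 hq1).mul_const (d 1 - β)).const_add β
    simpa using this
  have hlim' : Tendsto (fun t : ℕ => β + q ^ (t - 1) * (d 1 - β)) atTop (nhds β) :=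
    hlim.comp (tendsto_sub_atTop_nat 1)
  have hle : ∀ᶠ t in atTop, d t ≤ β + q ^ (t - 1) * (d 1 - β) := by
    filter_upwards [eventually_ge_atTop 1] with t ht
    obtain ⟨u, rfl⟩ := Nat.exists_eq_add_of_le' ht
    exact h1 u
  refine ⟨hlim'.isBoundedUnder_le.mono_le hle, ?_⟩
  rw [← hlim'.limsup_eq]
  exact limsup_le_limsup hle
    (isCoboundedUnder_le_of_le atTop fun t => hd0 t) hlim'.isBoundedUnder_le

end ALMA

end

theorem mainTheorem6 {L M n : ℕ} (hM : 2 ≤ M)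
    -- the model: layers of rank `K m`, weights with orthonormal columns, symmetric noise
    (K : Fin M → ℕ) (Qs : ALMA.Tensor M n)
    (hQsymm : ∀ m, (ALMA.slice Qs m).IsSymm)
    (hQrank : ∀ m, (ALMA.slice Qs m).rank = K m)
    (Ws : Matrix (Fin L) (Fin M) ℝ) (hWs : Wsᵀ * Ws = 1)
    (Δ : ALMA.Tensor L n) (hΔsymm : ∀ l, (ALMA.slice Δ l).IsSymm)
    -- the condition number `κ₀` is finite, and `L₁ ∩ L₂ = {0}`
    (hκ₀ : 0 < ALMA.sigma (ALMA.mode23 Qs Qs) M)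
    (hA1 : ALMA.L1 Qs ⊓ ALMA.L2 Qs = ⊥)
    -- the noise is small
    (hΔ : ALMA.tensorNorm Δ ≤ 1 / 4 * ALMA.sigmaMin K Qs)
    (ha : 2 * ALMA.CH Qs * ALMA.a1 K Qs Δ / (1 - ALMA.kappaH Qs) ≤ ALMA.radius K Qs Δ)
    -- the iterates for the observed tensor `A = P_* + Δ`, and their initialization
    (W : ℕ → Matrix (Fin L) (Fin M) ℝ) (Q : ℕ → ALMA.Tensor M n)
    (hWQ : ALMA.IsIterates (ALMA.trueTensor Qs Ws + Δ) K W Q)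
    (hinit : ALMA.dNorm Qs Ws (W 1 - Ws) ≤ ALMA.radius K Qs Δ) :
    (∀ t, 1 ≤ t →
      ALMA.dNorm Qs Ws (W (t + 1) - Ws)
        ≤ (1 + ALMA.kappaH Qs) / 2 * ALMA.dNorm Qs Ws (W t - Ws)
          + ALMA.CH Qs * ALMA.a1 K Qs Δ) ∧
    IsBoundedUnder (· ≤ ·) atTop (fun t => ALMA.dNorm Qs Ws (W t - Ws)) ∧
    limsup (fun t => ALMA.dNorm Qs Ws (W t - Ws)) atTop
      ≤ 2 * ALMA.CH Qs * ALMA.a1 K Qs Δ / (1 - ALMA.kappaH Qs) := by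
  have hq0 := ALMA.kappaH_nonneg Qs
  have hq1 := ALMA.kappaH_lt_one Qs hA1
  have hgap : 0 < 1 - ALMA.kappaH Qs := by linarith
  have hstep := fun (t : ℕ) (ht : 1 ≤ t) (hWt : (W t)ᵀ * W t = 1)
      (hRt : ALMA.dNorm Qs Ws (W t - Ws) ≤ ALMA.radius K Qs Δ) =>
    ALMA.step_contraction hM hQsymm hQrank hκ₀ hA1 hΔsymm hΔ ha hWs hWt hRt (hWQ.stepQ t ht)
  have hinv : ∀ t, 1 ≤ t → (W t)ᵀ * W t = 1 ∧
      ALMA.dNorm Qs Ws (W t - Ws) ≤ ALMA.radius K Qs Δ := by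
    intro t ht
    induction t, ht using Nat.le_induction with
    | base => exact ⟨hWQ.init, hinit⟩
    | succ t ht ih =>
      obtain ⟨h1, h2⟩ := hstep t ht ih.1 ih.2
      rw [← hWQ.stepW t ht] at h1 h2
      refine ⟨h1, h2.trans ?_⟩
      have h3 := mul_le_mul_of_nonneg_left ih.2
        (by linarith : (0 : ℝ) ≤ (1 + ALMA.kappaH Qs) / 2)
      rw [div_le_iff₀ hgap] at ha
      linarith
  have hrec : ∀ t, 1 ≤ t →
      ALMA.dNorm Qs Ws (W (t + 1) - Ws)
        ≤ (1 + ALMA.kappaH Qs) / 2 * ALMA.dNorm Qs Ws (W t - Ws)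
          + ALMA.CH Qs * ALMA.a1 K Qs Δ := fun t ht => by
    have h := (hstep t ht (hinv t ht).1 (hinv t ht).2).2
    rwa [← hWQ.stepW t ht] at h
  refine ⟨hrec, ALMA.limsup_le_of_contraction (by linarith) (by linarith)
    (fun t => ALMA.dNorm_nonneg Qs Ws _) ?_ hrec⟩
  field_simp
  ring
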